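/- **Setting.** Let $G=(V,E,w)$ be a finite undirected (simple) graph with positive edge weights, let $d_G$ be its shortest path distance ($d_G(u,v)=\infty$ if $u,v$ lie in different components), and let $K=\{t_1,\dots,t_k\}\subseteq V$ be $k\ge 2$ distinct terminals, in arbitrary order. Put $D(v)=\min_{t\in K}d_G(v,t)$. **The Noisy-Voronoi algorithm.** Set $\delta=\frac1{20\ln k}$, $p=\frac15$ and $V_\perp=V\setminus K$. For $j=1,\dots,k$: draw $g_j\in\{1,2,\dots\}$ independently with $\Pr[g_j=s]=(1-p)^{s-1}p$, set $R_j=(1+\delta)^{g_j}$, construct $V_j=\texttt{Create-Cluster}(G,V_\perp,t_j,R_j)$, and remove $V_j$ from $V_\perp$. Here Create-Cluster starts with $V_j=\{t_j\}$, $U=\emptyset$ and $N$ the set of neighbors of $t_j$ in $V_\perp$. While $N\neq\emptyset$ it removes an arbitrary vertex $v$ from $N$; if $d_G(v,t_j)\le R_j\cdot D(v)$, it adds $v$ to $V_j$ and adds all neighbors of $v$ in $V_\perp\setminus(U\cup V_j)$ to $N$; otherwise it adds $v$ to $U$. The algorithm returns the terminal-centered minor $M$ induced by $V_1,\dots,V_k$: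 its vertices are the terminals (each $V_i$ is contracted to $t_i$), $\{t_i,t_j\}$ with $i\ne j$ is an edge iff some edge of $G$ joins $V_i$ to $V_j$, and this edge has weight $d_G(t_i,t_j)$. Let $d_M$ be the shortest path distance of $M$. **Theorem.** There is a universal constant $c>0$ such that the following holds for every such $G$ and $t_1,\dots,t_k$. 1. For all values of the draws $g_1,\dots,g_k$ the algorithm has an output, and for every output (whatever vertices are extracted from $N$) the sets $V_1,\dots,V_k$ are pairwise disjoint, $t_i\in V_i$, each induced graph $G[V_i]$ is connected, every vertex of $G$ that is connected to some terminal belongs to some $V_i$ (so that $V_1,\dots,V_k$ partition $V$ if $G$ is connected), and $d_G(t,t')\le d_M(t,t')$ for all terminals $t,t'$. 2. With probability at least $1-\frac1k$ over the draws $g_1,\dots,g_k$, every minor $M$ that the algorithm may return (whatever vertices are extracted from $N$) satisfies $$d_M(t,t')\le c\,\log k\cdot d_G(t,t')\qquad\text{for all terminals }t,t'.$$ -/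

import Mathlib

open MeasureTheory ProbabilityTheory
open scoped ENNReal

namespace NoisyVoronoi

noncomputable section

/-- The total weight of a walk. -/
def walkWeight {V : Type*} {G : SimpleGraph V} (w : Sym2 V → ℝ≥0∞) {u v : V}
    (p : G.Walk u v) : ℝ≥0∞ :=
  (p.edges.map w).sum

/-- The shortest path distance `d_G(u, v)` of the graph `G` with edge weights `w`
(it is `∞` when no walk joins `u` and `v`). -/
def wdist {V : Type*} (G : SimpleGraph V) (w : Sym2 V → ℝ≥0∞) (u v : V) : ℝ≥0∞ :=
  ⨅ p : G.Walk u v, walkWeight w p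

theorem wdist_comm {V : Type*} (G : SimpleGraph V) (w : Sym2 V → ℝ≥0∞) (u v : V) :
    wdist G w u v = wdist G w v u := by
  have key : ∀ a b : V, wdist G w a b ≤ wdist G w b a := by
    intro a b
    refine le_iInf fun p => (iInf_le _ p.reverse).trans (le_of_eq ?_)
    simp [walkWeight, SimpleGraph.Walk.edges_reverse, List.sum_reverse]
  exact le_antisymm (key u v) (key v u)

/-- `D(v)`, the distance from `v` to its closest terminal. -/
def termDist {V : Type*} (G : SimpleGraph V) (w : Sym2 V → ℝ≥0∞) {k : ℕ} (t : Fin k → V)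
    (v : V) : ℝ≥0∞ :=
  ⨅ i, wdist G w v (t i)

/-- The while loop of `Create-Cluster`. `CreateClusterLoop G w t Vp j R C U N out` says that from
the current cluster `C`, the set `U` of refused vertices and the set `N` of waiting vertices, some
sequence of choices of the extracted vertex `v` makes the loop end with cluster `out`. Here `Vp` is
the set of unclustered vertices, `t j` the terminal that grows the cluster and `R` its magnitude. -/
inductive CreateClusterLoop {V : Type*} (G : SimpleGraph V) (w : Sym2 V → ℝ≥0∞) {k : ℕ}
    (t : Fin k → V) (Vp : Set V) (j : Fin k) (R : ℝ) :
    Set V → Set V → Set V → Set V → Prop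
  | done (C U : Set V) : CreateClusterLoop G w t Vp j R C U ∅ C
  | accept {C U N out : Set V} {v : V} (hv : v ∈ N)
      (h : wdist G w v (t j) ≤ ENNReal.ofReal R * termDist G w t v)
      (rest : CreateClusterLoop G w t Vp j R (insert v C) U
        ((N \ {v}) ∪ {u | G.Adj v u ∧ u ∈ Vp \ (U ∪ insert v C)}) out) :
      CreateClusterLoop G w t Vp j R C U N out
  | refuse {C U N out : Set V} {v : V} (hv : v ∈ N)
      (h : ¬ wdist G w v (t j) ≤ ENNReal.ofReal R * termDist G w t v)
      (rest : CreateClusterLoop G w t Vp j R C (insert v U) (N \ {v}) out) :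
      CreateClusterLoop G w t Vp j R C U N out

/-- `out` is a possible result of the procedure `Create-Cluster` for the terminal `t j`, the
set `Vp` of unclustered vertices and the magnitude `R`. -/
def CreateCluster {V : Type*} (G : SimpleGraph V) (w : Sym2 V → ℝ≥0∞) {k : ℕ}
    (t : Fin k → V) (Vp : Set V) (j : Fin k) (R : ℝ) (out : Set V) : Prop :=
  CreateClusterLoop G w t Vp j R {t j} ∅ {u | G.Adj (t j) u ∧ u ∈ Vp} out

/-- The set of unclustered non-terminal vertices at the beginning of round `j`, when the
clusters of the earlier rounds are `𝒱 i`, `i < j`. -/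
def unclustered {V : Type*} {k : ℕ} (t : Fin k → V) (𝒱 : Fin k → Set V) (j : Fin k) : Set V :=
  {v | v ∉ Set.range t ∧ ∀ i < j, v ∉ 𝒱 i}

/-- `δ = 1 / (20 ln k)`. -/
def delta (k : ℕ) : ℝ := 1 / (20 * Real.log k)

/-- `𝒱 0, …, 𝒱 (k - 1)` is a possible sequence of clusters built by the Noisy-Voronoi algorithm when
the random draws are `g`: round `j` runs `Create-Cluster` with magnitude `(1 + δ) ^ (g j)`. -/
def IsOutput {V : Type*} (G : SimpleGraph V) (w : Sym2 V → ℝ≥0∞) {k : ℕ} (t : Fin k → V)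
    (g : Fin k → ℕ) (𝒱 : Fin k → Set V) : Prop :=
  ∀ j, CreateCluster G w t (unclustered t 𝒱 j) j ((1 + delta k) ^ g j) (𝒱 j)

/-- Terminal partitions. When `G` is connected (or each component contains a terminal), `cover`
says that the clusters cover all the vertices, so that they partition the vertex set. -/
structure IsTerminalPartition {V : Type*} (G : SimpleGraph V) {k : ℕ} (t : Fin k → V)
    (𝒱 : Fin k → Set V) : Prop where
  terminal_mem : ∀ i, t i ∈ 𝒱 i
  connected : ∀ i, (G.induce (𝒱 i)).Connected
  disjoint : ∀ i j, i ≠ j → Disjoint (𝒱 i) (𝒱 j)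
  cover : ∀ v, (∃ i, G.Reachable (t i) v) → ∃ i, v ∈ 𝒱 i

/-- The minor induced by the clusters `𝒱`: each `𝒱 i` is contracted to the vertex `i`, which
stands for the terminal `t i`. -/
def inducedMinor {V : Type*} (G : SimpleGraph V) {k : ℕ} (𝒱 : Fin k → Set V) :
    SimpleGraph (Fin k) where
  Adj i j := i ≠ j ∧ ∃ a ∈ 𝒱 i, ∃ b ∈ 𝒱 j, G.Adj a b
  symm := ⟨fun _ _ ⟨hij, a, ha, b, hb, hab⟩ => ⟨hij.symm, b, hb, a, ha, hab.symm⟩⟩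
  loopless := ⟨fun _ h => h.1 rfl⟩

/-- The edge weights of the induced minor: the weight of `{i, j}` is `d_G(t i, t j)`. -/
def minorWeight {V : Type*} (G : SimpleGraph V) (w : Sym2 V → ℝ≥0∞) {k : ℕ} (t : Fin k → V) :
    Sym2 (Fin k) → ℝ≥0∞ :=
  Sym2.lift ⟨fun i j => wdist G w (t i) (t j), fun i j => wdist_comm G w (t i) (t j)⟩

/-- `d_M`, the shortest path distance of the weighted minor induced by the clusters `𝒱`. -/
def minorDist {V : Type*} (G : SimpleGraph V) (w : Sym2 V → ℝ≥0∞) {k : ℕ} (t : Fin k → V)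
    (𝒱 : Fin k → Set V) (i j : Fin k) : ℝ≥0∞ :=
  wdist (inducedMinor G 𝒱) (minorWeight G w t) i j

/-- The geometric distribution on `{1, 2, 3, …}`: the number of tosses up to and including the
first head (Mathlib's `geometricMeasure` counts the tails before it). -/
def geo (p : unitInterval) : Measure ℕ := (geometricMeasure p).map (· + 1)

/-- The joint law of the `k` independent draws, each geometric with parameter `1 / 5`. -/
def draws (k : ℕ) : Measure (Fin k → ℕ) :=
  Measure.pi fun _ => geo ⟨1 / 5, by norm_num, by norm_num⟩

end

end NoisyVoronoi

/-! The test that admits a vertex to a cluster does not depend on the order of extraction, so the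
draws determine the clusters, which are reachability sets (`IsOutput.eq_clusterOf`). This settles
the structural claims and leaves a statement about the draws alone.

For the distortion, fix a shortest path of length `L` between two terminals. In each round, the
stretch from the first to the last active path vertex in the new cluster is deactivated and bypassed
through the terminal of that cluster. If all magnitudes are at most `R`, the minor distance is at
most `L` plus `R` times the sum of `D` over the ends of these stretches (`minorDist_le_of_path`). As
`R` is bounded with high probability, it remains to bound that sum by `O(L / δ) = O(L log k)`.

Cut the path into intervals of length at most `δ / 4` times `D` at their start, and give each the
weight `δ * D`; the weights add up to at most `5 * L`. The active part of an interval splits into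
slices. A cluster that meets a slice swallows it once the magnitude grows by `1 + δ`
(`mem_cluster_of_sliceStart_eq`), and a geometric draw stops at a given level with conditional
probability only `1 / 5`. So a slice that is met is usually destroyed, and a round creates at most
one new slice, at the far end of its stretch (`exists_slice_step`). The loss of slice weight pays
for the charge of the ends: with potential equal to slice weight plus a tenth of the charge, `exp (η
* potential)` does not increase in expectation over a round
(`lintegral_exp_pathPotential_update_le`). Markov's inequality bounds the charge by `66 * L` up to
probability `k⁻⁴`, and a union bound over pairs of terminals and over large draws finishes the
proof. -/

namespace NoisyVoronoi

/-! ### Shortest path distances and the distance to the terminals -/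

section Distance

variable {V : Type*} {G : SimpleGraph V} {w : Sym2 V → ℝ≥0∞}

theorem walkWeight_cons {u v x : V} (h : G.Adj u v) (p : G.Walk v x) :
    walkWeight w (SimpleGraph.Walk.cons h p) = w s(u, v) + walkWeight w p := by
  simp [walkWeight]

theorem wdist_le_walkWeight {u v : V} (p : G.Walk u v) : wdist G w u v ≤ walkWeight w p :=
  iInf_le _ p

theorem wdist_self (u : V) : wdist G w u u = 0 :=
  le_antisymm ((wdist_le_walkWeight SimpleGraph.Walk.nil).trans (by simp [walkWeight])) bot_le

theorem wdist_triangle (u v x : V) : wdist G w u x ≤ wdist G w u v + wdist G w v x := by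
  refine ENNReal.le_iInf_add_iInf fun p q => ?_
  exact (wdist_le_walkWeight (p.append q)).trans (by simp [walkWeight])

theorem wdist_le_of_adj {u v : V} (h : G.Adj u v) : wdist G w u v ≤ w s(u, v) :=
  (wdist_le_walkWeight h.toWalk).trans (by simp [walkWeight])

theorem walkWeight_bypass_le [DecidableEq V] {u v : V} (p : G.Walk u v) :
    walkWeight w p.bypass ≤ walkWeight w p := by
  exact (p.edges_bypass_sublist_edges.map w).sum_le_sum fun _ _ => bot_le

theorem exists_walkWeight_eq_wdist [Finite V] {u v : V} (h : G.Reachable u v) :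
    ∃ p : G.Walk u v, walkWeight w p = wdist G w u v := by
  classical
  have : Nonempty (G.Path u v) := ⟨⟨h.some.bypass, h.some.bypass_isPath⟩⟩
  have := Fintype.ofFinite V
  obtain ⟨p, hp⟩ := Finite.exists_min fun p : G.Path u v => walkWeight w (p : G.Walk u v)
  refine ⟨p, le_antisymm (le_iInf fun q => ?_) (wdist_le_walkWeight _)⟩
  exact (hp ⟨q.bypass, q.bypass_isPath⟩).trans (walkWeight_bypass_le q)

theorem walkWeight_ne_top (hw : ∀ e ∈ G.edgeSet, w e < ∞) {u v : V} (p : G.Walk u v) :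
    walkWeight w p ≠ ∞ := by
  induction p with
  | nil => simp [walkWeight]
  | cons h p ih =>
    rw [walkWeight_cons]
    exact ENNReal.add_ne_top.2 ⟨(hw _ h).ne, ih⟩

theorem reachable_of_wdist_ne_top {u v : V} (h : wdist G w u v ≠ ∞) : G.Reachable u v := by
  by_contra hr
  refine h ?_
  have : IsEmpty (G.Walk u v) := ⟨fun p => hr ⟨p⟩⟩
  exact iInf_of_empty _

variable {k : ℕ} {t : Fin k → V}

theorem termDist_le (i : Fin k) (v : V) : termDist G w t v ≤ wdist G w v (t i) :=
  iInf_le _ i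

theorem termDist_terminal (i : Fin k) : termDist G w t (t i) = 0 :=
  le_antisymm ((termDist_le i _).trans (wdist_self _).le) bot_le

theorem termDist_le_add (u v : V) : termDist G w t u ≤ wdist G w u v + termDist G w t v := by
  rw [termDist, termDist, ENNReal.add_iInf]
  exact iInf_mono fun i => wdist_triangle u v (t i)

/-- Every vertex that is joined to a terminal and is not one itself has a neighbor through which
a shortest path to the closest terminal leaves it. -/
theorem exists_adj_termDist_eq [Finite V] (v : V) (hv : v ∉ Set.range t)
    (h : ∃ i, G.Reachable (t i) v) :
    ∃ u, G.Adj v u ∧ (∃ i, G.Reachable (t i) u) ∧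
      w s(v, u) + termDist G w t u ≤ termDist G w t v := by
  obtain ⟨i₀, hi₀⟩ := h
  have : Nonempty (Fin k) := ⟨i₀⟩
  by_cases htop : termDist G w t v = ∞
  · obtain ⟨p⟩ := hi₀.symm
    cases p with
    | nil => exact absurd ⟨i₀, rfl⟩ hv
    | cons h p => exact ⟨_, h, ⟨i₀, p.reachable.symm⟩, htop ▸ le_top⟩
  · obtain ⟨i, hi⟩ := Finite.exists_min fun i => wdist G w v (t i)
    have hD : termDist G w t v = wdist G w v (t i) := le_antisymm (termDist_le i v) (le_iInf hi)
    obtain ⟨p, hp⟩ := exists_walkWeight_eq_wdist (w := w)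
      (reachable_of_wdist_ne_top (hD ▸ htop))
    rw [hD, ← hp]
    cases p with
    | nil => exact absurd ⟨i, rfl⟩ hv
    | cons h p =>
      refine ⟨_, h, ⟨i, p.reachable.symm⟩, ?_⟩
      rw [walkWeight_cons]
      gcongr
      exact (termDist_le i _).trans (wdist_le_walkWeight p)

theorem walkWeight_eq_sum_getVert {u v : V} (p : G.Walk u v) :
    walkWeight w p = ∑ i ∈ Finset.range p.length, w s(p.getVert i, p.getVert (i + 1)) := by
  induction p with
  | nil => simp [walkWeight]
  | cons h p ih =>
    rw [walkWeight_cons, SimpleGraph.Walk.length_cons, Finset.sum_range_succ', ih, add_comm]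
    simp

theorem minorWeight_eq (i j : Fin k) : minorWeight G w t s(i, j) = wdist G w (t i) (t j) := rfl

theorem wdist_le_minorDist (𝒱 : Fin k → Set V) (i j : Fin k) :
    wdist G w (t i) (t j) ≤ minorDist G w t 𝒱 i j := by
  refine le_iInf fun p => ?_
  induction p with
  | nil => simp [wdist_self]
  | cons h p ih =>
    rw [walkWeight_cons]
    exact (wdist_triangle _ _ _).trans (add_le_add le_rfl ih)

end Distance

end NoisyVoronoi

namespace NoisyVoronoi

/-! ### Clusters as reachability sets; the terminal partition -/

section Clusters

variable {V : Type*} {G : SimpleGraph V} {w : Sym2 V → ℝ≥0∞} {k : ℕ} {t : Fin k → V}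

/-- The vertices that the terminal `t j` can reach through unclustered vertices `v` that satisfy
`d_G(v, t j) ≤ R * D(v)`. -/
def cluster (G : SimpleGraph V) (w : Sym2 V → ℝ≥0∞) (t : Fin k → V) (Vp : Set V) (j : Fin k)
    (R : ℝ) : Set V :=
  {v | Relation.ReflTransGen (fun a b => G.Adj a b ∧ b ∈ Vp ∧
    wdist G w b (t j) ≤ ENNReal.ofReal R * termDist G w t b) (t j) v}

variable {Vp : Set V} {j : Fin k} {R : ℝ}

theorem terminal_mem_cluster : t j ∈ cluster G w t Vp j R := Relation.ReflTransGen.refl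

theorem mem_cluster_of_adj {a b : V} (ha : a ∈ cluster G w t Vp j R) (h : G.Adj a b)
    (hb : b ∈ Vp) (hd : wdist G w b (t j) ≤ ENNReal.ofReal R * termDist G w t b) :
    b ∈ cluster G w t Vp j R :=
  Relation.ReflTransGen.tail ha ⟨h, hb, hd⟩

theorem wdist_le_of_mem_cluster {v : V} (hv : v ∈ cluster G w t Vp j R) :
    wdist G w v (t j) ≤ ENNReal.ofReal R * termDist G w t v := by
  rcases Relation.ReflTransGen.cases_tail hv with h | ⟨_, _, h⟩
  · rw [h, wdist_self]
    exact bot_le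
  · exact h.2.2

theorem mem_of_mem_cluster {v : V} (hv : v ∈ cluster G w t Vp j R) : v = t j ∨ v ∈ Vp := by
  rcases Relation.ReflTransGen.cases_tail hv with h | ⟨_, _, h⟩
  · exact .inl h
  · exact .inr h.2.1

theorem cluster_mono {R' : ℝ} (h : R ≤ R') : cluster G w t Vp j R ⊆ cluster G w t Vp j R' :=
  fun _ hv => Relation.ReflTransGen.mono
    (fun _ _ hab => ⟨hab.1, hab.2.1, hab.2.2.trans (by gcongr)⟩) _ _ hv

theorem induce_cluster_connected : (G.induce (cluster G w t Vp j R)).Connected := by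
  have key : ∀ v (hv : v ∈ cluster G w t Vp j R),
      (G.induce (cluster G w t Vp j R)).Reachable ⟨t j, terminal_mem_cluster⟩ ⟨v, hv⟩ := by
    intro v hv
    induction (hv : Relation.ReflTransGen _ _ _) with
    | refl => exact .rfl
    | tail h₁ h₂ ih =>
      refine ih.trans (SimpleGraph.Adj.reachable ?_)
      exact h₂.1
  exact (SimpleGraph.connected_iff_exists_forall_reachable _).2
    ⟨⟨t j, terminal_mem_cluster⟩, fun v => key v v.2⟩

/-- The hypotheses are the loop invariants. A refusal depends only on the vertex, not on the current
cluster, so it is never regretted; when `N` is empty, the cluster is closed under admissible steps.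
-/
theorem CreateClusterLoop.eq_cluster {C U N out : Set V}
    (h : CreateClusterLoop G w t Vp j R C U N out) (htj : t j ∈ C)
    (hC : C ⊆ cluster G w t Vp j R) (hN : ∀ v ∈ N, v ∈ Vp ∧ ∃ a ∈ C, G.Adj a v)
    (hU : ∀ v ∈ U, ¬ wdist G w v (t j) ≤ ENNReal.ofReal R * termDist G w t v)
    (hbd : ∀ a ∈ C, ∀ v ∈ Vp, G.Adj a v → v ∈ C ∨ v ∈ U ∨ v ∈ N) :
    out = cluster G w t Vp j R := by
  induction h with
  | done C U =>
    refine hC.antisymm fun v hv => ?_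
    induction (hv : Relation.ReflTransGen _ _ _) with
    | refl => exact htj
    | tail h₁ h₂ ih =>
      rcases hbd _ ih _ h₂.2.1 h₂.1 with h | h | h
      · exact h
      · exact absurd h₂.2.2 (hU _ h)
      · exact h.elim
  | @accept C U N out v hv h rest ih =>
    obtain ⟨hvV, a, ha, hav⟩ := hN v hv
    refine ih (.inr htj) ?_ ?_ hU ?_
    · rintro x (rfl | hx)
      · exact mem_cluster_of_adj (hC ha) hav hvV h
      · exact hC hx
    · rintro x (hx | hx)
      · obtain ⟨hx, b, hb, hbx⟩ := hN x hx.1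
        exact ⟨hx, b, .inr hb, hbx⟩
      · exact ⟨hx.2.1, v, .inl rfl, hx.1⟩
    · intro b hb x hx hbx
      by_cases hxC : x ∈ insert v C
      · exact .inl hxC
      by_cases hxU : x ∈ U
      · exact .inr (.inl hxU)
      refine .inr (.inr ?_)
      rcases hb with rfl | hb
      · exact .inr ⟨hbx, hx, fun h => h.elim hxU hxC⟩
      · rcases hbd b hb x hx hbx with h | h | h
        · exact absurd (.inr h) hxC
        · exact absurd h hxU
        · exact .inl ⟨h, fun h => hxC (.inl h)⟩
  | @refuse C U N out v hv h rest ih =>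
    refine ih htj hC (fun x hx => hN x hx.1) ?_ ?_
    · rintro x (rfl | hx)
      · exact h
      · exact hU x hx
    · intro b hb x hx hbx
      by_cases hxv : x = v
      · exact .inr (.inl (.inl hxv))
      rcases hbd b hb x hx hbx with h | h | h
      · exact .inl h
      · exact .inr (.inl (.inr h))
      · exact .inr (.inr ⟨h, hxv⟩)

theorem CreateCluster.eq_cluster {out : Set V} (h : CreateCluster G w t Vp j R out) :
    out = cluster G w t Vp j R := by
  refine CreateClusterLoop.eq_cluster h rfl ?_ ?_ ?_ ?_
  · rintro _ rfl
    exact terminal_mem_cluster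
  · exact fun v hv => ⟨hv.2, _, rfl, hv.1⟩
  · exact fun _ h => h.elim
  · rintro _ rfl v hv h
    exact .inr (.inr ⟨h, hv⟩)

/-- Termination: each pass moves a vertex of `N` into `C ∪ U`. Disjointness makes the complement of
`C ∪ U` shrink strictly. -/
theorem exists_createClusterLoop [Finite V] (C U N : Set V) (hN : Disjoint N (C ∪ U)) :
    ∃ out, CreateClusterLoop G w t Vp j R C U N out := by
  induction hn : ((C ∪ U)ᶜ).ncard using Nat.strong_induction_on generalizing C U N with
  | _ n ih =>
    subst hn
    rcases N.eq_empty_or_nonempty with rfl | ⟨v, hv⟩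
    · exact ⟨C, .done C U⟩
    have hvn : v ∈ (C ∪ U)ᶜ := fun h => Set.disjoint_left.1 hN hv h
    have hdis : ∀ x ∈ N, x ∉ C ∪ U := fun x hx => Set.disjoint_left.1 hN hx
    by_cases h : wdist G w v (t j) ≤ ENNReal.ofReal R * termDist G w t v
    · obtain ⟨out, ho⟩ := ih _ (Set.ncard_lt_ncard (t := (C ∪ U)ᶜ)
        (s := (insert v C ∪ U)ᶜ) ⟨by gcongr; exact Set.subset_insert _ _,
          fun hs => hs hvn (.inl (.inl rfl))⟩ (Set.toFinite _)) (insert v C) U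
        ((N \ {v}) ∪ {u | G.Adj v u ∧ u ∈ Vp \ (U ∪ insert v C)}) (by
          rw [Set.disjoint_left]
          rintro x (⟨hx, hxv⟩ | hx) hxC
          · rcases hxC with (hxC | hxC) | hxC
            · exact hxv hxC
            · exact hdis x hx (.inl hxC)
            · exact hdis x hx (.inr hxC)
          · exact hx.2.2 (Set.union_comm _ _ ▸ hxC)) rfl
      exact ⟨out, .accept hv h ho⟩
    · obtain ⟨out, ho⟩ := ih _ (Set.ncard_lt_ncard (t := (C ∪ U)ᶜ)
        (s := (C ∪ insert v U)ᶜ) ⟨by gcongr; exact Set.subset_insert _ _,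
          fun hs => hs hvn (.inr (.inl rfl))⟩ (Set.toFinite _)) C (insert v U) (N \ {v}) (by
          rw [Set.disjoint_left]
          rintro x ⟨hx, hxv⟩ (hxC | hxC | hxC)
          · exact hdis x hx (.inl hxC)
          · exact hxv hxC
          · exact hdis x hx (.inr hxC)) rfl
      exact ⟨out, .refuse hv h ho⟩

theorem createCluster_cluster [Finite V] : CreateCluster G w t Vp j R (cluster G w t Vp j R) := by
  obtain ⟨out, h⟩ := exists_createClusterLoop (G := G) (w := w) (t := t) (Vp := Vp) (j := j)
    (R := R) {t j} ∅ {u | G.Adj (t j) u ∧ u ∈ Vp} (by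
      rw [Set.disjoint_left]
      rintro x hx (rfl | h)
      · exact hx.1.ne rfl
      · exact h)
  have h' : CreateCluster G w t Vp j R out := h
  exact h'.eq_cluster ▸ h'

/-- The set of unclustered non-terminal vertices after `n` rounds, for the draws `g`. -/
def perp (G : SimpleGraph V) (w : Sym2 V → ℝ≥0∞) (t : Fin k → V) (g : Fin k → ℕ) : ℕ → Set V
  | 0 => (Set.range t)ᶜ
  | n + 1 => {v | v ∈ perp G w t g n ∧
      ∀ h : n < k, v ∉ cluster G w t (perp G w t g n) ⟨n, h⟩ ((1 + delta k) ^ g ⟨n, h⟩)}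

/-- The cluster of round `j`, for the draws `g`. -/
def clusterOf (G : SimpleGraph V) (w : Sym2 V → ℝ≥0∞) (t : Fin k → V) (g : Fin k → ℕ)
    (j : Fin k) : Set V :=
  cluster G w t (perp G w t g j) j ((1 + delta k) ^ g j)

variable {g : Fin k → ℕ} {𝒱 : Fin k → Set V}

theorem mem_perp_iff (n : ℕ) (v : V) :
    v ∈ perp G w t g n ↔ v ∉ Set.range t ∧ ∀ i : Fin k, (i : ℕ) < n → v ∉ clusterOf G w t g i := by
  induction n with
  | zero => simp [perp]
  | succ n ih =>
    simp only [perp, Set.mem_ofPred_eq, ih]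
    constructor
    · rintro ⟨⟨h₁, h₂⟩, h₃⟩
      refine ⟨h₁, fun i hi => ?_⟩
      rcases Nat.lt_succ_iff_lt_or_eq.1 hi with h | rfl
      · exact h₂ i h
      · exact h₃ i.2
    · rintro ⟨h₁, h₂⟩
      exact ⟨⟨h₁, fun i hi => h₂ i (by omega)⟩, fun h => h₂ ⟨n, h⟩ (by simp)⟩

/-- The past does not depend on the present draw; this is what allows one draw at a time to be
integrated out. -/
theorem perp_congr {g' : Fin k → ℕ} (n : ℕ) (h : ∀ i : Fin k, (i : ℕ) < n → g i = g' i) :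
    perp G w t g n = perp G w t g' n := by
  induction n with
  | zero => rfl
  | succ n ih =>
    simp only [perp]
    rw [ih fun i hi => h i (by omega)]
    ext v
    refine and_congr_right fun _ => forall_congr' fun hn => ?_
    rw [h ⟨n, hn⟩ (by simp)]

theorem unclustered_clusterOf (j : Fin k) :
    unclustered t (clusterOf G w t g) j = perp G w t g j := by
  ext v
  rw [mem_perp_iff]
  rfl

theorem isOutput_clusterOf [Finite V] : IsOutput G w t g (clusterOf G w t g) := fun j => by
  rw [unclustered_clusterOf]
  exact createCluster_cluster

theorem IsOutput.eq_clusterOf (h : IsOutput G w t g 𝒱) : 𝒱 = clusterOf G w t g := by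
  funext j
  induction j using WellFoundedLT.induction with
  | _ j ih =>
    have hu : unclustered t 𝒱 j = perp G w t g j := by
      rw [← unclustered_clusterOf]
      ext v
      refine and_congr_right fun _ => forall₂_congr fun i hi => ?_
      rw [ih i hi]
    rw [(h j).eq_cluster, hu]
    rfl

theorem delta_nonneg (k : ℕ) : 0 ≤ delta k :=
  div_nonneg zero_le_one (mul_nonneg (by norm_num) (Real.log_natCast_nonneg k))

theorem one_le_radius (k s : ℕ) : 1 ≤ (1 + delta k) ^ s :=
  one_le_pow₀ (by linarith [delta_nonneg k])

/-- Take an uncovered `x` with `D(x)` minimal. Its neighbor `u` on a shortest path to the nearest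
terminal is covered, say by cluster `i`. Since the magnitude is at least `1`, the test that `u`
passed extends along the edge to `x`, which was still unclustered in round `i`. -/
theorem exists_mem_clusterOf [Finite V] (hw : ∀ e ∈ G.edgeSet, 0 < w e ∧ w e < ∞) (v : V)
    (hv : ∃ i, G.Reachable (t i) v) : ∃ i, v ∈ clusterOf G w t g i := by
  by_contra hcon
  let S : Set V := {v | (∃ i, G.Reachable (t i) v) ∧ ¬ ∃ i, v ∈ clusterOf G w t g i}
  obtain ⟨x, hx, hmin⟩ := (Set.toFinite S).exists_minimalFor (termDist G w t) S ⟨v, hv, hcon⟩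
  have hxt : x ∉ Set.range t := by
    rintro ⟨i, rfl⟩
    exact hx.2 ⟨i, terminal_mem_cluster⟩
  obtain ⟨u, hxu, hu, hd⟩ := exists_adj_termDist_eq (w := w) x hxt hx.1
  obtain ⟨i₀, hi₀⟩ := hx.1
  -- Finiteness is what makes a positive edge weight give a strict decrease in `ℝ≥0∞`.
  have hfin : termDist G w t x ≠ ∞ := by
    obtain ⟨p⟩ := hi₀.symm
    exact ne_top_of_le_ne_top (walkWeight_ne_top (fun e he => (hw e he).2) p)
      ((termDist_le i₀ x).trans (wdist_le_walkWeight p))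
  have hwe := hw s(x, u) hxu
  have hlt : termDist G w t u < termDist G w t x := by
    refine lt_of_lt_of_le ?_ hd
    rw [add_comm]
    exact ENNReal.lt_add_right (ne_top_of_le_ne_top hfin (le_add_self.trans hd)) hwe.1.ne'
  have huc : ∃ i, u ∈ clusterOf G w t g i := by
    by_contra h
    exact absurd (hmin (j := u) ⟨hu, h⟩ hlt.le) (not_le.2 hlt)
  obtain ⟨i, hi⟩ := huc
  refine hx.2 ⟨i, mem_cluster_of_adj hi hxu.symm ?_ ?_⟩
  · exact (mem_perp_iff _ _).2 ⟨hxt, fun l _ h => hx.2 ⟨l, h⟩⟩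
  · have hR : (1 : ℝ≥0∞) ≤ ENNReal.ofReal ((1 + delta k) ^ g i) := by
      rw [← ENNReal.ofReal_one]
      exact ENNReal.ofReal_le_ofReal (one_le_radius k _)
    calc wdist G w x (t i) ≤ wdist G w x u + wdist G w u (t i) := wdist_triangle _ _ _
      _ ≤ ENNReal.ofReal ((1 + delta k) ^ g i) * w s(x, u)
          + ENNReal.ofReal ((1 + delta k) ^ g i) * termDist G w t u := by
        refine add_le_add ((wdist_le_of_adj hxu).trans ?_) (wdist_le_of_mem_cluster hi)
        exact le_mul_of_one_le_left bot_le hR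
      _ ≤ _ := by
        rw [← mul_add]
        gcongr

theorem clusterOf_disjoint (ht : Function.Injective t) {i j : Fin k} (hij : i < j) :
    Disjoint (clusterOf G w t g i) (clusterOf G w t g j) := by
  rw [Set.disjoint_left]
  intro v hi hj
  rcases mem_of_mem_cluster hj with rfl | h
  · rcases mem_of_mem_cluster hi with h | h
    · exact hij.ne' (ht h)
    · exact ((mem_perp_iff _ _).1 h).1 ⟨j, rfl⟩
  · exact ((mem_perp_iff _ _).1 h).2 i hij hi

theorem eq_of_terminal_mem_clusterOf (ht : Function.Injective t) {i j : Fin k}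
    (h : t i ∈ clusterOf G w t g j) : i = j := by
  rcases mem_of_mem_cluster h with h | h
  · exact ht h
  · exact absurd ⟨i, rfl⟩ ((mem_perp_iff _ _).1 h).1

theorem isTerminalPartition_clusterOf [Finite V] (hw : ∀ e ∈ G.edgeSet, 0 < w e ∧ w e < ∞)
    (ht : Function.Injective t) : IsTerminalPartition G t (clusterOf G w t g) where
  terminal_mem _ := terminal_mem_cluster
  connected _ := induce_cluster_connected
  disjoint i j hij := by
    rcases lt_or_gt_of_ne hij with h | h
    · exact clusterOf_disjoint ht h
    · exact (clusterOf_disjoint ht h).symm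
  cover := exists_mem_clusterOf hw

end Clusters

end NoisyVoronoi

namespace NoisyVoronoi

/-! ### Slices and the change of the potential in one round -/

section Slices

/-- The slices of a finite set `A` of indices are the maximal runs of consecutive elements of `A`
with the same label `s`; `sliceStart s A i` is the first element of the slice of `i ∈ A`. -/
def sliceStart (s : ℕ → ℕ) (A : Finset ℕ) : ℕ → ℕ
  | 0 => 0
  | i + 1 => if i ∈ A ∧ s i = s (i + 1) then sliceStart s A i else i + 1

variable {s : ℕ → ℕ} {A : Finset ℕ}

theorem sliceStart_succ_of {i : ℕ} (h : i ∈ A ∧ s i = s (i + 1)) :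
    sliceStart s A (i + 1) = sliceStart s A i := if_pos h

theorem sliceStart_succ_of_not {i : ℕ} (h : ¬ (i ∈ A ∧ s i = s (i + 1))) :
    sliceStart s A (i + 1) = i + 1 := if_neg h

theorem sliceStart_le (i : ℕ) : sliceStart s A i ≤ i := by
  induction i with
  | zero => exact le_rfl
  | succ i ih =>
    by_cases h : i ∈ A ∧ s i = s (i + 1)
    · rw [sliceStart_succ_of h]; omega
    · rw [sliceStart_succ_of_not h]

/-- Slices are convex: nothing between the start of a slice and one of its elements leaves it. -/
theorem sliceStart_eq_of_mem_Icc {i x : ℕ} (h₁ : sliceStart s A i ≤ x) (h₂ : x ≤ i) :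
    sliceStart s A x = sliceStart s A i ∧ s x = s i ∧ (i ∈ A → x ∈ A) := by
  induction i with
  | zero => obtain rfl : x = 0 := by omega
            exact ⟨rfl, rfl, id⟩
  | succ i ih =>
    rcases h₂.eq_or_lt with rfl | h₂
    · exact ⟨rfl, rfl, id⟩
    by_cases h : i ∈ A ∧ s i = s (i + 1)
    · rw [sliceStart_succ_of h] at h₁ ⊢
      obtain ⟨h₃, h₄, h₅⟩ := ih h₁ (by omega)
      exact ⟨h₃, h₄.trans h.2, fun _ => h₅ h.1⟩
    · rw [sliceStart_succ_of_not h] at h₁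
      omega

theorem sliceStart_sliceStart (i : ℕ) :
    sliceStart s A (sliceStart s A i) = sliceStart s A i :=
  (sliceStart_eq_of_mem_Icc le_rfl (sliceStart_le i)).1

theorem label_sliceStart (i : ℕ) : s (sliceStart s A i) = s i :=
  (sliceStart_eq_of_mem_Icc le_rfl (sliceStart_le i)).2.1

theorem sliceStart_mem {i : ℕ} (h : i ∈ A) : sliceStart s A i ∈ A :=
  (sliceStart_eq_of_mem_Icc le_rfl (sliceStart_le i)).2.2 h

/-- The sum over the slices of `A` of the weight `μ` of their label. -/
def sliceSum (s : ℕ → ℕ) (μ : ℕ → ℝ) (A : Finset ℕ) : ℝ :=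
  ∑ i ∈ A with sliceStart s A i = i, μ (s i)

variable {μ : ℕ → ℝ}

/-- Removing an interval of indices destroys the slices that start in it and creates at most one
new slice, which starts just after the interval. -/
theorem sliceSum_sdiff_Icc_le (hμ : ∀ i, 0 ≤ μ i) (a b : ℕ) :
    sliceSum s μ (A \ Finset.Icc a b) +
        ∑ i ∈ A with sliceStart s A i = i ∧ i ∈ Finset.Icc a b, μ (s i)
      ≤ sliceSum s μ A + if b + 1 ∈ A ∧ s b = s (b + 1) then μ (s b) else 0 := by
  classical
  set A' := A \ Finset.Icc a b with hA'
  have hstart : ∀ i ∈ A', sliceStart s A' i = i →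
      sliceStart s A i = i ∨ (i = b + 1 ∧ s b = s (b + 1)) := by
    intro i hi h
    rcases i with _ | x
    · exact .inl rfl
    by_cases hx : x ∈ A ∧ s x = s (x + 1)
    · right
      by_cases hxA : x ∈ A'
      · rw [sliceStart_succ_of ⟨hxA, hx.2⟩] at h
        have := sliceStart_le (s := s) (A := A') x
        omega
      · rw [hA', Finset.mem_sdiff, Finset.mem_Icc] at hxA hi
        have hxI : a ≤ x ∧ x ≤ b := not_not.1 fun h' => hxA ⟨hx.1, h'⟩
        -- A new start has its predecessor inside the removed interval and lies itself outside, so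
        -- it can only be `b + 1`.
        obtain rfl : x = b := by
          have := hi.2
          omega
        exact ⟨rfl, hx.2⟩
    · exact .inl (sliceStart_succ_of_not hx)
  have hsub : (A'.filter fun i => sliceStart s A' i = i) ⊆
      (A.filter fun i => sliceStart s A i = i ∧ i ∉ Finset.Icc a b) ∪
        (if b + 1 ∈ A ∧ s b = s (b + 1) then {b + 1} else ∅) := by
    intro i hi
    rw [Finset.mem_filter] at hi
    have hi' := hi.1
    rw [hA', Finset.mem_sdiff] at hi'
    rw [Finset.mem_union]
    rcases hstart i hi.1 hi.2 with h | ⟨rfl, h⟩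
    · exact .inl (Finset.mem_filter.2 ⟨hi'.1, h, hi'.2⟩)
    · right
      rw [if_pos ⟨hi'.1, h⟩]
      exact Finset.mem_singleton_self _
  have h₁ : sliceSum s μ A' ≤ ∑ i ∈ A with sliceStart s A i = i ∧ i ∉ Finset.Icc a b, μ (s i) +
      if b + 1 ∈ A ∧ s b = s (b + 1) then μ (s b) else 0 := by
    refine (Finset.sum_le_sum_of_subset_of_nonneg hsub fun _ _ _ => hμ _).trans ?_
    have hui := Finset.sum_union_inter (f := fun i => μ (s i))
      (s₁ := A.filter fun i => sliceStart s A i = i ∧ i ∉ Finset.Icc a b)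
      (s₂ := if b + 1 ∈ A ∧ s b = s (b + 1) then {b + 1} else ∅)
    have hpos : 0 ≤ ∑ i ∈ (A.filter fun i => sliceStart s A i = i ∧ i ∉ Finset.Icc a b) ∩
      (if b + 1 ∈ A ∧ s b = s (b + 1) then {b + 1} else ∅), μ (s i) :=
      Finset.sum_nonneg fun _ _ => hμ _
    have hnew : ∑ i ∈ (if b + 1 ∈ A ∧ s b = s (b + 1) then {b + 1} else ∅), μ (s i) =
        if b + 1 ∈ A ∧ s b = s (b + 1) then μ (s b) else 0 := by
      split_ifs with h
      · rw [Finset.sum_singleton, h.2]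
      · rfl
    linarith
  have h₂ : sliceSum s μ A = ∑ i ∈ A with sliceStart s A i = i ∧ i ∈ Finset.Icc a b, μ (s i) +
      ∑ i ∈ A with sliceStart s A i = i ∧ i ∉ Finset.Icc a b, μ (s i) := by
    rw [sliceSum, ← Finset.sum_filter_add_sum_filter_not _ (· ∈ Finset.Icc a b),
      Finset.filter_filter, Finset.filter_filter]
  linarith

open Classical in
/-- The elements of `A` in the set `Z`. -/
noncomputable def touched (A : Finset ℕ) (Z : Set ℕ) : Finset ℕ := A.filter (· ∈ Z)

/-- What is left of `A` when the interval spanned by `T` is removed. -/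
def removeSpan (A T : Finset ℕ) : Finset ℕ :=
  if h : T.Nonempty then A \ Finset.Icc (T.min' h) (T.max' h) else A

/-- The weight of the two ends of `T`. -/
def endCharge (s : ℕ → ℕ) (μ : ℕ → ℝ) (T : Finset ℕ) : ℝ :=
  if h : T.Nonempty then μ (s (T.min' h)) + μ (s (T.max' h)) else 0

/-- The total weight of the slices of `A` that meet `T`. -/
def touchedSum (s : ℕ → ℕ) (μ : ℕ → ℝ) (A T : Finset ℕ) : ℝ :=
  ∑ l ∈ T.image (sliceStart s A), μ (s l)

theorem mem_touched {Z : Set ℕ} {i : ℕ} : i ∈ touched A Z ↔ i ∈ A ∧ i ∈ Z := by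
  classical
  exact Finset.mem_filter

/-- If the slices that meet `T₀` are contained in `T₁`, then the weight of the slices decreases by
that of those that meet `T₀`, up to the weight of the slices of the ends of `T₁` that do not. -/
theorem exists_slice_step (hμ : ∀ i, 0 ≤ μ i) {M : ℝ} (hM₀ : 0 ≤ M) (hM : ∀ i ∈ A, μ (s i) ≤ M)
    {T₀ T₁ : Finset ℕ} (hT : T₁ ⊆ A) (h₀ : T₀ ⊆ T₁)
    (hfill : ∀ i ∈ T₀, ∀ i' ∈ A, sliceStart s A i = sliceStart s A i' → i' ∈ T₁) :
    ∃ x, 0 ≤ x ∧ x ≤ 2 * M ∧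
      sliceSum s μ (removeSpan A T₁) + endCharge s μ T₁ / 10 ≤
        sliceSum s μ A + 11 / 10 * x - 4 / 5 * touchedSum s μ A T₀ ∧
      touchedSum s μ A T₀ + x / 2 ≤ touchedSum s μ A T₁ := by
  classical
  by_cases hne : T₁.Nonempty
  swap
  · obtain rfl := Finset.not_nonempty_iff_eq_empty.1 hne
    obtain rfl := Finset.subset_empty.1 h₀
    refine ⟨0, le_rfl, ?_, ?_, ?_⟩
    · linarith
    · simp [removeSpan, endCharge, touchedSum]
    · simp [touchedSum]
  set a := T₁.min' hne with ha
  set b := T₁.max' hne with hb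
  have haT : a ∈ T₁ := T₁.min'_mem hne
  have hbT : b ∈ T₁ := T₁.max'_mem hne
  set I₀ := T₀.image (sliceStart s A) with hI₀
  set I₁ := T₁.image (sliceStart s A) with hI₁
  have hI : I₀ ⊆ I₁ := Finset.image_subset_image h₀
  have haI : sliceStart s A a ∈ I₁ := Finset.mem_image_of_mem _ haT
  have hbI : sliceStart s A b ∈ I₁ := Finset.mem_image_of_mem _ hbT
  set W₀ := touchedSum s μ A T₀ with hW₀
  set xa := if sliceStart s A a ∈ I₀ then 0 else μ (s a) with hxa
  set xb := if sliceStart s A b ∈ I₀ then 0 else μ (s b) with hxb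
  -- The weight of an end slice counts only if the slice misses `T₀`; otherwise it is already part
  -- of `W₀`. Hence the two ends weigh at most `xa + xb + 2 * W₀`, and a tenth of this turns the
  -- gain `W₀` into `4 / 5 * W₀`.
  have hnew : ∀ c ∈ T₁, 0 ≤ (if sliceStart s A c ∈ I₀ then 0 else μ (s c)) ∧
      (if sliceStart s A c ∈ I₀ then 0 else μ (s c)) ≤ M ∧
      W₀ + (if sliceStart s A c ∈ I₀ then 0 else μ (s c)) ≤ touchedSum s μ A T₁ ∧
      μ (s c) ≤ (if sliceStart s A c ∈ I₀ then 0 else μ (s c)) + W₀ := by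
    intro c hc
    have hcI : sliceStart s A c ∈ I₁ := Finset.mem_image_of_mem _ hc
    split_ifs with h
    · refine ⟨le_rfl, (hμ _).trans (hM c (hT hc)), ?_, ?_⟩
      · rw [add_zero]
        exact Finset.sum_le_sum_of_subset_of_nonneg hI fun _ _ _ => hμ _
      · rw [zero_add, ← label_sliceStart (s := s) (A := A) c]
        exact Finset.single_le_sum (f := fun l => μ (s l)) (fun _ _ => hμ _) h
    · refine ⟨hμ _, hM c (hT hc), ?_, ?_⟩
      · rw [← label_sliceStart (s := s) (A := A) c, add_comm, hW₀, touchedSum,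
          ← Finset.sum_insert (f := fun l => μ (s l)) h]
        exact Finset.sum_le_sum_of_subset_of_nonneg
          (Finset.insert_subset hcI hI) fun _ _ _ => hμ _
      · have : 0 ≤ W₀ := Finset.sum_nonneg fun _ _ => hμ _
        linarith
  obtain ⟨a₁, a₂, a₃, a₄⟩ := hnew a haT
  obtain ⟨b₁, b₂, b₃, b₄⟩ := hnew b hbT
  rw [← hxa] at a₁ a₂ a₃ a₄
  rw [← hxb] at b₁ b₂ b₃ b₄
  -- Both ends may lie in the same slice, so only half of `xa + xb` is certain to be new touched
  -- weight.
  refine ⟨xa + xb, by linarith, by linarith, ?_, by linarith⟩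
  rw [removeSpan, dif_pos hne, endCharge, dif_pos hne, ← ha, ← hb]
  have hcut := sliceSum_sdiff_Icc_le (s := s) (A := A) hμ a b
  have hin : W₀ ≤ ∑ i ∈ A with sliceStart s A i = i ∧ i ∈ Finset.Icc a b, μ (s i) := by
    refine Finset.sum_le_sum_of_subset_of_nonneg (fun l hl => ?_) fun _ _ _ => hμ _
    obtain ⟨i, hi, rfl⟩ := Finset.mem_image.1 hl
    have hmem : sliceStart s A i ∈ T₁ := hfill i hi _ (sliceStart_mem (hT (h₀ hi)))
      (sliceStart_sliceStart i).symm
    exact Finset.mem_filter.2 ⟨hT hmem, sliceStart_sliceStart i,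
      Finset.mem_Icc.2 ⟨T₁.min'_le _ hmem, T₁.le_max' _ hmem⟩⟩
  -- If the slice of `b` met `T₀`, then `b + 1` would belong to `T₁`, beyond its maximum. So only a
  -- slice missed by `T₀` can leave a remainder.
  have hsplit : (if b + 1 ∈ A ∧ s b = s (b + 1) then μ (s b) else 0) ≤ xb := by
    split_ifs with h
    · rw [hxb, if_neg]
      intro hbI₀
      obtain ⟨i, hi, hib⟩ := Finset.mem_image.1 hbI₀
      have := T₁.le_max' _ (hfill i hi (b + 1) h.1 (by
        rw [hib, sliceStart_succ_of ⟨hT hbT, h.2⟩]))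
      omega
    · exact b₁
  linarith

/-- The linear terms have the negative sum `(11 / 50 - 8 / 25) * x = -x / 10`. With `|exp y - 1 - y|
≤ y ^ 2`, the quadratic error is at most `0.37 * x ^ 2`, which `x ≤ 1 / 4` absorbs. -/
theorem exp_mixture_le {x : ℝ} (h₀ : 0 ≤ x) (h₁ : x ≤ 1 / 4) :
    1 / 5 * Real.exp (11 / 10 * x) + 4 / 5 * Real.exp (-(2 / 5 * x)) ≤ 1 := by
  have e₁ := Real.abs_exp_sub_one_sub_id_le (x := 11 / 10 * x)
    (by rw [abs_le]; constructor <;> linarith)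
  have e₂ := Real.abs_exp_sub_one_sub_id_le (x := -(2 / 5 * x))
    (by rw [abs_le]; constructor <;> linarith)
  have e₃ := (abs_le.1 e₁).2
  have e₄ := (abs_le.1 e₂).2
  nlinarith

/-- One step of the telescoping sum that bounds the exponential moment of a round. -/
theorem exp_step_le {η Y Y' W₀ W₁ x : ℝ} (hη : 0 ≤ η) (hx₀ : 0 ≤ x) (hx₁ : η * x ≤ 1 / 4)
    (hY : Y' ≤ Y + 11 / 10 * x - 4 / 5 * W₀) (hW : W₀ + x / 2 ≤ W₁) :
    1 / 5 * Real.exp (η * Y') + 4 / 5 * Real.exp (η * (Y - 4 / 5 * W₁)) ≤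
      Real.exp (η * (Y - 4 / 5 * W₀)) := by
  have h₁ : Real.exp (η * Y') ≤
      Real.exp (η * (Y - 4 / 5 * W₀)) * Real.exp (11 / 10 * (η * x)) := by
    rw [← Real.exp_add]
    exact Real.exp_le_exp.2 (by nlinarith)
  have h₂ : Real.exp (η * (Y - 4 / 5 * W₁)) ≤
      Real.exp (η * (Y - 4 / 5 * W₀)) * Real.exp (-(2 / 5 * (η * x))) := by
    rw [← Real.exp_add]
    exact Real.exp_le_exp.2 (by nlinarith)
  have h₃ := exp_mixture_le (mul_nonneg hη hx₀) hx₁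
  nlinarith [Real.exp_pos (η * (Y - 4 / 5 * W₀))]

end Slices

end NoisyVoronoi

namespace NoisyVoronoi

/-! ### Active indices and the sequence of detours -/

section Detours

/-- The indices of `{0, …, n}` that are still active after `j` rounds: round `j` hits the active
indices in `Z j` and deactivates the whole interval that they span. -/
noncomputable def activeSet (n : ℕ) (Z : ℕ → Set ℕ) : ℕ → Finset ℕ
  | 0 => Finset.range (n + 1)
  | j + 1 => removeSpan (activeSet n Z j) (touched (activeSet n Z j) (Z j))

/-- The active indices that are hit in round `j`. -/
noncomputable def hitSet (n : ℕ) (Z : ℕ → Set ℕ) (j : ℕ) : Finset ℕ :=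
  touched (activeSet n Z j) (Z j)

/-- The index `i` lies in the interval spanned by `T`. -/
def InSpan (T : Finset ℕ) (i : ℕ) : Prop :=
  ∃ h : T.Nonempty, T.min' h ≤ i ∧ i ≤ T.max' h

variable {n : ℕ} {Z : ℕ → Set ℕ}

theorem mem_removeSpan {A T : Finset ℕ} {i : ℕ} :
    i ∈ removeSpan A T ↔ i ∈ A ∧ ¬ InSpan T i := by
  by_cases h : T.Nonempty
  · simp [removeSpan, InSpan, h]
  · simp [removeSpan, InSpan, h]

theorem mem_activeSet {j i : ℕ} :
    i ∈ activeSet n Z j ↔ i ≤ n ∧ ∀ l < j, ¬ InSpan (hitSet n Z l) i := by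
  induction j with
  | zero => simp [activeSet]
  | succ j ih =>
    rw [activeSet, mem_removeSpan, ih]
    constructor
    · rintro ⟨⟨h₁, h₂⟩, h₃⟩
      refine ⟨h₁, fun l hl => ?_⟩
      rcases Nat.lt_succ_iff_lt_or_eq.1 hl with h | rfl
      · exact h₂ l h
      · exact h₃
    · rintro ⟨h₁, h₂⟩
      exact ⟨⟨h₁, fun l hl => h₂ l (by omega)⟩, h₂ j (by omega)⟩

theorem inSpan_of_mem {T : Finset ℕ} {i : ℕ} (h : i ∈ T) : InSpan T i :=
  ⟨⟨i, h⟩, T.min'_le i h, T.le_max' i h⟩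

theorem not_inSpan_of_mem_hitSet {j l i : ℕ} (h : i ∈ hitSet n Z j) (hl : l < j) :
    ¬ InSpan (hitSet n Z l) i :=
  (mem_activeSet.1 (mem_touched.1 h).1).2 l hl

theorem not_mem_of_mem_activeSet {j l i : ℕ} (h : i ∈ activeSet n Z j) (hl : l < j) : i ∉ Z l :=
  fun hi => (mem_activeSet.1 h).2 l hl (inSpan_of_mem (mem_touched.2
    ⟨mem_activeSet.2 ⟨(mem_activeSet.1 h).1, fun l' hl' => (mem_activeSet.1 h).2 l' (hl'.trans hl)⟩,
      hi⟩))

/-- `j` is the last round that deactivates the index `i`. -/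
def IsLastSpan (n : ℕ) (Z : ℕ → Set ℕ) (j i : ℕ) : Prop :=
  InSpan (hitSet n Z j) i ∧ ∀ l, j < l → ¬ InSpan (hitSet n Z l) i

/-- Otherwise span `j` would also contain `i + 1`, whose last span `j'` is then later. Span `j'`
avoids `i`, so it starts at `i + 1`; but its first element was hit while active, hence not
deactivated by round `j`. -/
theorem max_eq_of_isLastSpan {j j' i : ℕ} (h : IsLastSpan n Z j i)
    (h' : IsLastSpan n Z j' (i + 1)) (hne : j ≠ j') :
    i = (hitSet n Z j).max' h.1.choose := by
  obtain ⟨hn, h₁, h₂⟩ := h.1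
  refine le_antisymm h₂ (not_lt.1 fun hlt => ?_)
  have hin : InSpan (hitSet n Z j) (i + 1) := ⟨hn, by omega, hlt⟩
  have hjj : j < j' := lt_of_le_of_ne (not_lt.1 fun hl => h'.2 j hl hin) hne
  obtain ⟨hn', h₁', h₂'⟩ := h'.1
  have hmin : (hitSet n Z j').min' hn' = i + 1 :=
    le_antisymm h₁' (not_lt.1 fun hl => h.2 j' hjj ⟨hn', by omega, by omega⟩)
  exact not_inSpan_of_mem_hitSet (hmin ▸ (hitSet n Z j').min'_mem hn') hjj hin

theorem min_eq_of_isLastSpan {j j' i : ℕ} (h : IsLastSpan n Z j i)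
    (h' : IsLastSpan n Z j' (i + 1)) (hne : j ≠ j') :
    i + 1 = (hitSet n Z j').min' h'.1.choose := by
  obtain ⟨hn', h₁', h₂'⟩ := h'.1
  refine le_antisymm (not_lt.1 fun hlt => ?_) h₁'
  have hin : InSpan (hitSet n Z j') i := ⟨hn', by omega, by omega⟩
  have hjj : j' < j := lt_of_le_of_ne (not_lt.1 fun hl => h.2 j' hl hin) hne.symm
  obtain ⟨hn, h₁, h₂⟩ := h.1
  have hmax : (hitSet n Z j).max' hn = i :=
    le_antisymm (not_lt.1 fun hl => h'.2 j hjj ⟨hn, by omega, by omega⟩) h₂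
  exact not_inSpan_of_mem_hitSet (hmax ▸ (hitSet n Z j).max'_mem hn) hjj hin

theorem exists_isLastSpan {k : ℕ} (hZ : ∀ j, k ≤ j → Z j = ∅) (hk : activeSet n Z k = ∅) {i : ℕ}
    (hi : i ≤ n) : ∃ j : Fin k, IsLastSpan n Z j i := by
  classical
  have hlt : ∀ j, InSpan (hitSet n Z j) i → j < k := by
    rintro j ⟨⟨x, hx⟩, -⟩
    by_contra hj
    have := (mem_touched.1 hx).2
    rw [hZ j (not_lt.1 hj)] at this
    exact this
  obtain ⟨j₀, hj₀⟩ : ∃ j, InSpan (hitSet n Z j) i := by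
    by_contra hcon
    have : i ∈ activeSet n Z k := mem_activeSet.2 ⟨hi, fun l _ h => hcon ⟨l, h⟩⟩
    rw [hk] at this
    exact absurd this (Finset.notMem_empty i)
  have hsp := Nat.findGreatest_spec (P := fun j => InSpan (hitSet n Z j) i) (hlt j₀ hj₀).le hj₀
  refine ⟨⟨_, hlt _ hsp⟩, hsp, fun l hl h => ?_⟩
  exact Nat.findGreatest_is_greatest hl (hlt l h).le h

/-- The sum of the values of `f` at the two ends of `T`. -/
noncomputable def endSum (f : ℕ → ℝ≥0∞) (T : Finset ℕ) : ℝ≥0∞ :=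
  if h : T.Nonempty then f (T.min' h) + f (T.max' h) else 0

/-- If the steps inside the last spans are free and those between last spans are paid for by their
length and by the ends of the spans, then the whole path is paid for. -/
theorem le_sum_add_sum_endSum {k : ℕ} {d : Fin k → Fin k → ℝ≥0∞} (hself : ∀ i, d i i = 0)
    (htri : ∀ i j l, d i l ≤ d i j + d j l) {κ : ℕ → Fin k}
    (hκ : ∀ i ≤ n, IsLastSpan n Z (κ i) i) {ℓ f : ℕ → ℝ≥0∞} {R : ℝ≥0∞}
    (hstep : ∀ i < n, ∀ j j' : Fin k, j ≠ j' → i ∈ hitSet n Z j → i + 1 ∈ hitSet n Z j' →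
      d j j' ≤ ℓ i + R * (f i + f (i + 1))) :
    d (κ 0) (κ n) ≤ ∑ i ∈ Finset.range n, ℓ i + R * ∑ j : Fin k, endSum f (hitSet n Z j) := by
  classical
  have hchain : ∀ x, d (κ 0) (κ x) ≤ ∑ i ∈ Finset.range x, d (κ i) (κ (i + 1)) := by
    intro x
    induction x with
    | zero => simp [hself]
    | succ x ih =>
      rw [Finset.sum_range_succ]
      exact (htri _ (κ x) _).trans (by gcongr)
  -- The places where the route changes terminals. It leaves each terminal only at the maximum of
  -- its hit set and enters only at the minimum, hence at most once each; so every end is charged at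
  -- most once.
  set S := (Finset.range n).filter fun i => κ i ≠ κ (i + 1) with hS
  have hmax : ∀ i ∈ S, i < n ∧ ∃ h : (hitSet n Z (κ i)).Nonempty,
      i = (hitSet n Z (κ i)).max' h := by
    intro i hi
    obtain ⟨hi, hne⟩ := Finset.mem_filter.1 hi
    have hi := Finset.mem_range.1 hi
    exact ⟨hi, _, max_eq_of_isLastSpan (hκ i hi.le) (hκ (i + 1) hi) fun h => hne (Fin.ext h)⟩
  have hmin : ∀ i ∈ S, ∃ h : (hitSet n Z (κ (i + 1))).Nonempty,
      i + 1 = (hitSet n Z (κ (i + 1))).min' h := by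
    intro i hi
    obtain ⟨hi, hne⟩ := Finset.mem_filter.1 hi
    have hi := Finset.mem_range.1 hi
    exact ⟨_, min_eq_of_isLastSpan (hκ i hi.le) (hκ (i + 1) hi) fun h => hne (Fin.ext h)⟩
  let fmax : Fin k → ℝ≥0∞ := fun j =>
    if h : (hitSet n Z j).Nonempty then f ((hitSet n Z j).max' h) else 0
  let fmin : Fin k → ℝ≥0∞ := fun j =>
    if h : (hitSet n Z j).Nonempty then f ((hitSet n Z j).min' h) else 0
  have hsum₁ : ∑ i ∈ S, f i ≤ ∑ j, fmax j := by
    have hinj : Set.InjOn κ S := by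
      intro i hi i' hi' h
      obtain ⟨_, hn, e⟩ := hmax i hi
      obtain ⟨_, hn', e'⟩ := hmax i' hi'
      simp only [h] at e
      exact e.trans e'.symm
    calc ∑ i ∈ S, f i = ∑ i ∈ S, fmax (κ i) := Finset.sum_congr rfl fun i hi => by
            obtain ⟨_, hn, e⟩ := hmax i hi
            simp only [fmax, dif_pos hn, ← e]
      _ = ∑ j ∈ S.image κ, fmax j := (Finset.sum_image hinj).symm
      _ ≤ _ := Finset.sum_le_sum_of_subset (Finset.subset_univ _)
  have hsum₂ : ∑ i ∈ S, f (i + 1) ≤ ∑ j, fmin j := by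
    have hinj : Set.InjOn (fun i => κ (i + 1)) S := by
      intro i hi i' hi' h
      obtain ⟨hn, e⟩ := hmin i hi
      obtain ⟨hn', e'⟩ := hmin i' hi'
      simp only at h
      simp only [h] at e
      omega
    calc ∑ i ∈ S, f (i + 1) = ∑ i ∈ S, fmin (κ (i + 1)) := Finset.sum_congr rfl fun i hi => by
            obtain ⟨hn, e⟩ := hmin i hi
            simp only [fmin, dif_pos hn, ← e]
      _ = ∑ j ∈ S.image fun i => κ (i + 1), fmin j := (Finset.sum_image hinj).symm
      _ ≤ _ := Finset.sum_le_sum_of_subset (Finset.subset_univ _)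
  have hend : ∑ j : Fin k, endSum f (hitSet n Z j) = ∑ j, fmin j + ∑ j, fmax j := by
    rw [← Finset.sum_add_distrib]
    refine Finset.sum_congr rfl fun j _ => ?_
    by_cases h : (hitSet n Z j).Nonempty
    · simp [endSum, fmin, fmax, h]
    · simp [endSum, fmin, fmax, h]
  have hterm : ∀ i ∈ S, d (κ i) (κ (i + 1)) ≤ ℓ i + R * (f i + f (i + 1)) := by
    intro i hi
    obtain ⟨hin, hn, e⟩ := hmax i hi
    obtain ⟨hn', e'⟩ := hmin i hi
    refine hstep i hin _ _ (Finset.mem_filter.1 hi).2 ?_ ?_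
    · exact (congrArg (· ∈ hitSet n Z (κ i)) e).mpr (Finset.max'_mem _ hn)
    · exact (congrArg (· ∈ hitSet n Z (κ (i + 1))) e').mpr (Finset.min'_mem _ hn')
  calc d (κ 0) (κ n) ≤ ∑ i ∈ Finset.range n, d (κ i) (κ (i + 1)) := hchain n
    _ = ∑ i ∈ S, d (κ i) (κ (i + 1)) := by
      refine (Finset.sum_filter_of_ne (p := fun i => κ i ≠ κ (i + 1)) fun i _ h heq => h ?_).symm
      rw [← heq, hself]
    _ ≤ ∑ i ∈ S, (ℓ i + R * (f i + f (i + 1))) := Finset.sum_le_sum hterm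
    _ = ∑ i ∈ S, ℓ i + R * (∑ i ∈ S, f (i + 1) + ∑ i ∈ S, f i) := by
      rw [Finset.sum_add_distrib, ← Finset.mul_sum, Finset.sum_add_distrib,
        add_comm (∑ i ∈ S, f i)]
    _ ≤ _ := by
      rw [hend]
      gcongr
      exact Finset.filter_subset _ _

end Detours

/-! ### From detours along a path to a walk in the minor -/

section Minor

variable {V : Type*} {G : SimpleGraph V} {w : Sym2 V → ℝ≥0∞} {k : ℕ} {t : Fin k → V}

/-- The indices of the path `v` whose vertices belong to the cluster of round `j`. -/
def clusterIndices (G : SimpleGraph V) (w : Sym2 V → ℝ≥0∞) (t : Fin k → V) (g : Fin k → ℕ)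
    (v : ℕ → V) (j : ℕ) : Set ℕ :=
  {i | ∃ h : j < k, v i ∈ clusterOf G w t g ⟨j, h⟩}

variable {g : Fin k → ℕ} {v : ℕ → V} {n : ℕ}

theorem mem_clusterOf_of_mem_hitSet {j : Fin k} {i : ℕ}
    (h : i ∈ hitSet n (clusterIndices G w t g v) j) : v i ∈ clusterOf G w t g j :=
  (mem_touched.1 h).2.2

theorem activeSet_eq_empty [Finite V] (hw : ∀ e ∈ G.edgeSet, 0 < w e ∧ w e < ∞)
    (hv : ∀ i ≤ n, ∃ j, G.Reachable (t j) (v i)) :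
    activeSet n (clusterIndices G w t g v) k = ∅ := by
  refine Finset.eq_empty_of_forall_notMem fun i hi => ?_
  obtain ⟨j, hj⟩ := exists_mem_clusterOf (g := g) hw (v i) (hv i (mem_activeSet.1 hi).1)
  exact not_mem_of_mem_activeSet hi j.2 ⟨j.2, hj⟩

theorem reachable_path (hadj : ∀ i < n, G.Adj (v i) (v (i + 1))) {i : ℕ} (hi : i ≤ n) :
    G.Reachable (v 0) (v i) := by
  induction i with
  | zero => exact .rfl
  | succ i ih => exact (ih (by omega)).trans (hadj i hi).reachable

/-- Assign to each index the last round that deactivates it. Where the assignment changes, both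
endpoints of the path edge really lie in the respective clusters, so the edge gives a minor edge, of
weight at most the edge plus the distances of its endpoints to the two terminals. -/
theorem minorDist_le_of_path [Finite V] (hw : ∀ e ∈ G.edgeSet, 0 < w e ∧ w e < ∞)
    (ht : Function.Injective t) {i₀ i₁ : Fin k} (h₀ : v 0 = t i₀) (h₁ : v n = t i₁)
    (hadj : ∀ i < n, G.Adj (v i) (v (i + 1))) {R : ℝ≥0∞}
    (hR : ∀ j, ENNReal.ofReal ((1 + delta k) ^ g j) ≤ R) :
    minorDist G w t (clusterOf G w t g) i₀ i₁ ≤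
      ∑ i ∈ Finset.range n, w s(v i, v (i + 1)) +
        R * ∑ j : Fin k, endSum (fun i => termDist G w t (v i))
          (hitSet n (clusterIndices G w t g v) j) := by
  have hlast : ∀ i ≤ n, ∃ j : Fin k, IsLastSpan n (clusterIndices G w t g v) j i := by
    refine fun i => exists_isLastSpan (fun j hj => ?_) (activeSet_eq_empty hw fun i hi => ?_)
    · ext i
      simp [clusterIndices, not_lt.2 hj]
    · exact ⟨i₀, h₀ ▸ reachable_path hadj hi⟩
  have : Nonempty (Fin k) := ⟨i₀⟩
  choose! κ hκ using hlast
  -- A span containing `0` has minimum `0`, so `t i₀` lies in that cluster, and a terminal lies only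
  -- in its own.
  have hκ₀ : κ 0 = i₀ := by
    obtain ⟨hn, h, -⟩ := (hκ 0 (Nat.zero_le n)).1
    have hm := mem_clusterOf_of_mem_hitSet (Finset.min'_mem _ hn)
    rw [Nat.le_zero.1 h, h₀] at hm
    exact (eq_of_terminal_mem_clusterOf ht hm).symm
  have hκ₁ : κ n = i₁ := by
    obtain ⟨hn, -, h⟩ := (hκ n le_rfl).1
    have hmem := Finset.max'_mem _ hn
    have hm := mem_clusterOf_of_mem_hitSet hmem
    rw [le_antisymm (mem_activeSet.1 (mem_touched.1 hmem).1).1 h, h₁] at hm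
    exact (eq_of_terminal_mem_clusterOf ht hm).symm
  rw [← hκ₀, ← hκ₁]
  refine le_sum_add_sum_endSum (fun i => wdist_self i) (fun i j l => wdist_triangle i j l) hκ ?_
  intro i hi j j' hne hj hj'
  have hj := mem_clusterOf_of_mem_hitSet hj
  have hj' := mem_clusterOf_of_mem_hitSet hj'
  have hadjM : (inducedMinor G (clusterOf G w t g)).Adj j j' :=
    ⟨hne, _, hj, _, hj', hadj i hi⟩
  calc minorDist G w t (clusterOf G w t g) j j' ≤ wdist G w (t j) (t j') :=
        (wdist_le_of_adj hadjM).trans (minorWeight_eq j j').le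
    _ ≤ wdist G w (v i) (t j) + (w s(v i, v (i + 1)) + wdist G w (v (i + 1)) (t j')) := by
      refine (wdist_triangle _ (v i) _).trans (add_le_add (wdist_comm _ _ _ _).le ?_)
      exact (wdist_triangle _ (v (i + 1)) _).trans (by gcongr; exact wdist_le_of_adj (hadj i hi))
    _ ≤ R * termDist G w t (v i) +
        (w s(v i, v (i + 1)) + R * termDist G w t (v (i + 1))) := by
      gcongr
      · exact (wdist_le_of_mem_cluster hj).trans (mul_le_mul_left (hR j) _)
      · exact (wdist_le_of_mem_cluster hj').trans (mul_le_mul_left (hR j') _)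
    _ = _ := by ring

end Minor

end NoisyVoronoi

namespace NoisyVoronoi

/-! ### The greedy partition of a path into intervals -/

section Intervals

/-- The first index of the interval of `i` in the greedy partition of a path with positions `pos`
into intervals whose length is at most `δ / 4` times the value of `D` at their first index. -/
noncomputable def intervalStart (δ : ℝ) (pos D : ℕ → ℝ) : ℕ → ℕ
  | 0 => 0
  | i + 1 => open Classical in
    if pos (i + 1) - pos (intervalStart δ pos D i) ≤ δ / 4 * D (intervalStart δ pos D i) then
      intervalStart δ pos D i else i + 1

variable {δ : ℝ} {pos D : ℕ → ℝ}

theorem intervalStart_succ_of {i : ℕ}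
    (h : pos (i + 1) - pos (intervalStart δ pos D i) ≤ δ / 4 * D (intervalStart δ pos D i)) :
    intervalStart δ pos D (i + 1) = intervalStart δ pos D i := if_pos h

theorem intervalStart_succ_of_not {i : ℕ}
    (h : ¬ pos (i + 1) - pos (intervalStart δ pos D i) ≤ δ / 4 * D (intervalStart δ pos D i)) :
    intervalStart δ pos D (i + 1) = i + 1 := if_neg h

theorem intervalStart_le (i : ℕ) : intervalStart δ pos D i ≤ i := by
  induction i with
  | zero => exact le_rfl
  | succ i ih =>
    by_cases h : pos (i + 1) - pos (intervalStart δ pos D i) ≤ δ / 4 * D (intervalStart δ pos D i)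
    · rw [intervalStart_succ_of h]; omega
    · rw [intervalStart_succ_of_not h]

theorem pos_sub_intervalStart_le (hδ : 0 ≤ δ) (hD : ∀ i, 0 ≤ D i) (i : ℕ) :
    pos i - pos (intervalStart δ pos D i) ≤ δ / 4 * D (intervalStart δ pos D i) := by
  have hnn : ∀ x, 0 ≤ δ / 4 * D x := fun x => mul_nonneg (by linarith) (hD x)
  induction i with
  | zero => simpa [intervalStart] using hnn 0
  | succ i ih =>
    by_cases h : pos (i + 1) - pos (intervalStart δ pos D i) ≤ δ / 4 * D (intervalStart δ pos D i)
    · rw [intervalStart_succ_of h]; exact h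
    · rw [intervalStart_succ_of_not h, sub_self]; exact hnn _

/-- A new interval starts only when the position has advanced by more than `δ / 4 * D` of the old
start, so four times the advance pays for its weight. Only the last interval is unpaid. -/
theorem sum_intervalStart_le (hpos : pos 0 = 0) (n : ℕ) :
    ∑ i ∈ Finset.range (n + 1) with intervalStart δ pos D i = i, δ * D i ≤
      4 * pos (intervalStart δ pos D n) + δ * D (intervalStart δ pos D n) := by
  induction n with
  | zero =>
    simp [intervalStart, hpos, Finset.filter_singleton]
  | succ n ih =>
    rw [Finset.range_add_one, Finset.filter_insert]
    by_cases h : pos (n + 1) - pos (intervalStart δ pos D n) ≤ δ / 4 * D (intervalStart δ pos D n)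
    · rw [intervalStart_succ_of h, if_neg]
      · exact ih
      · have := intervalStart_le (δ := δ) (pos := pos) (D := D) n
        omega
    · rw [intervalStart_succ_of_not h, if_pos rfl, Finset.sum_insert (by simp)]
      linarith

/-- The slices of the whole path are its intervals, and their weights sum up to a constant times
the length of the path. -/
theorem sliceSum_range_le (hD : ∀ i, 0 ≤ D i) (hδ : 0 ≤ δ) (hpos : pos 0 = 0) (n : ℕ) :
    sliceSum (intervalStart δ pos D) (fun i => δ * D i) (Finset.range (n + 1)) ≤
      4 * pos (intervalStart δ pos D n) + δ * D (intervalStart δ pos D n) := by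
  refine le_trans ?_ (sum_intervalStart_le hpos n)
  have key : ∀ i ∈ Finset.range (n + 1),
      sliceStart (intervalStart δ pos D) (Finset.range (n + 1)) i = i →
        intervalStart δ pos D i = i := by
    intro i hi h
    rcases i with _ | i
    · rfl
    by_contra hne
    have hs : intervalStart δ pos D (i + 1) = intervalStart δ pos D i := by
      refine intervalStart_succ_of ?_
      by_contra hlt
      exact hne (intervalStart_succ_of_not hlt)
    have hi : i ∈ Finset.range (n + 1) :=
      Finset.mem_range.2 (lt_of_lt_of_le (Nat.lt_succ_self i) (Finset.mem_range.1 hi).le)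
    rw [sliceStart_succ_of ⟨hi, hs.symm⟩] at h
    have := sliceStart_le (s := intervalStart δ pos D) (A := Finset.range (n + 1)) i
    omega
  rw [sliceSum]
  calc _ = ∑ i ∈ Finset.range (n + 1) with
        sliceStart (intervalStart δ pos D) (Finset.range (n + 1)) i = i, δ * D i := by
        refine Finset.sum_congr rfl fun i hi => ?_
        rw [key i (Finset.mem_filter.1 hi).1 (Finset.mem_filter.1 hi).2]
    _ ≤ _ := by
        refine Finset.sum_le_sum_of_subset_of_nonneg (fun i hi => ?_) fun i _ _ =>
          mul_nonneg hδ (hD i)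
        exact Finset.mem_filter.2 ⟨(Finset.mem_filter.1 hi).1,
          key i (Finset.mem_filter.1 hi).1 (Finset.mem_filter.1 hi).2⟩

end Intervals

/-! ### Slices of a path against growing clusters -/

section Path

variable {V : Type*} {G : SimpleGraph V} {w : Sym2 V → ℝ≥0∞} {k : ℕ} {t : Fin k → V}

/-- The positions of the vertices of a path, measured along the path. -/
noncomputable def pathPos (w : Sym2 V → ℝ≥0∞) (v : ℕ → V) (i : ℕ) : ℝ :=
  ∑ x ∈ Finset.range i, (w s(v x, v (x + 1))).toReal

/-- The distances of the vertices of a path from their closest terminals. -/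
noncomputable def pathDist (G : SimpleGraph V) (w : Sym2 V → ℝ≥0∞) (t : Fin k → V) (v : ℕ → V)
    (i : ℕ) : ℝ :=
  (termDist G w t (v i)).toReal

/-- The intervals of a path. -/
noncomputable def pathStart (G : SimpleGraph V) (w : Sym2 V → ℝ≥0∞) (t : Fin k → V) (v : ℕ → V) :
    ℕ → ℕ :=
  intervalStart (delta k) (pathPos w v) (pathDist G w t v)

variable {v : ℕ → V} {n : ℕ}

theorem pathDist_nonneg (i : ℕ) : 0 ≤ pathDist G w t v i := ENNReal.toReal_nonneg

theorem pathPos_mono : Monotone (pathPos w v) :=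
  monotone_nat_of_le_succ fun i => by
    rw [pathPos, pathPos, Finset.sum_range_succ]
    exact le_add_of_nonneg_right ENNReal.toReal_nonneg

theorem pathPos_zero : pathPos w v 0 = 0 := Finset.sum_range_zero _

theorem pathPos_lt (hw : ∀ e ∈ G.edgeSet, 0 < w e ∧ w e < ∞)
    (hadj : ∀ i < n, G.Adj (v i) (v (i + 1))) {i j : ℕ} (hij : i < j) (hj : j ≤ n) :
    pathPos w v i < pathPos w v j := by
  refine lt_of_lt_of_le ?_ (pathPos_mono hij)
  rw [pathPos, pathPos, Finset.sum_range_succ]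
  have := hw s(v i, v (i + 1)) (hadj i (by omega))
  exact lt_add_of_pos_right _ (ENNReal.toReal_pos this.1.ne' this.2.ne)

theorem wdist_path_le (hw : ∀ e ∈ G.edgeSet, 0 < w e ∧ w e < ∞)
    (hadj : ∀ i < n, G.Adj (v i) (v (i + 1))) {i j : ℕ} (hij : i ≤ j) (hj : j ≤ n) :
    wdist G w (v i) (v j) ≤ ENNReal.ofReal (pathPos w v j - pathPos w v i) := by
  induction j, hij using Nat.le_induction with
  | base => simp [wdist_self]
  | succ j hij ih =>
    have hj' := hadj j (by omega)
    refine (wdist_triangle _ (v j) _).trans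
      ((add_le_add (ih (by omega)) (wdist_le_of_adj hj')).trans ?_)
    rw [← ENNReal.ofReal_toReal (hw _ hj').2.ne, ← ENNReal.ofReal_add
      (sub_nonneg.2 (pathPos_mono hij)) ENNReal.toReal_nonneg]
    refine ENNReal.ofReal_le_ofReal (le_of_eq ?_)
    rw [pathPos, pathPos, pathPos, Finset.sum_range_succ]
    ring

theorem wdist_path_le_abs (hw : ∀ e ∈ G.edgeSet, 0 < w e ∧ w e < ∞)
    (hadj : ∀ i < n, G.Adj (v i) (v (i + 1))) {i j : ℕ} (hi : i ≤ n) (hj : j ≤ n) :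
    wdist G w (v i) (v j) ≤ ENNReal.ofReal |pathPos w v i - pathPos w v j| := by
  rcases le_total i j with h | h
  · rw [abs_sub_comm]
    exact (wdist_path_le hw hadj h hj).trans (ENNReal.ofReal_le_ofReal (le_abs_self _))
  · rw [wdist_comm]
    exact (wdist_path_le hw hadj h hi).trans (ENNReal.ofReal_le_ofReal (le_abs_self _))

variable {i₀ : Fin k}

theorem termDist_path_le (hw : ∀ e ∈ G.edgeSet, 0 < w e ∧ w e < ∞) (h₀ : v 0 = t i₀)
    (hadj : ∀ i < n, G.Adj (v i) (v (i + 1))) {i : ℕ} (hi : i ≤ n) :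
    termDist G w t (v i) ≤ ENNReal.ofReal (pathPos w v i) := by
  refine (termDist_le i₀ _).trans ?_
  rw [← h₀, wdist_comm]
  simpa [pathPos_zero] using wdist_path_le hw hadj (Nat.zero_le i) hi

theorem ofReal_pathDist (hw : ∀ e ∈ G.edgeSet, 0 < w e ∧ w e < ∞) (h₀ : v 0 = t i₀)
    (hadj : ∀ i < n, G.Adj (v i) (v (i + 1))) {i : ℕ} (hi : i ≤ n) :
    ENNReal.ofReal (pathDist G w t v i) = termDist G w t (v i) :=
  ENNReal.ofReal_toReal (ne_top_of_le_ne_top ENNReal.ofReal_ne_top (termDist_path_le hw h₀ hadj hi))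

theorem pathDist_le_pathPos (hw : ∀ e ∈ G.edgeSet, 0 < w e ∧ w e < ∞) (h₀ : v 0 = t i₀)
    (hadj : ∀ i < n, G.Adj (v i) (v (i + 1))) {i : ℕ} (hi : i ≤ n) :
    pathDist G w t v i ≤ pathPos w v i :=
  ENNReal.toReal_le_of_le_ofReal (pathPos_zero (w := w) (v := v) ▸ pathPos_mono (Nat.zero_le i))
    (termDist_path_le hw h₀ hadj hi)

theorem pathDist_le_add (hw : ∀ e ∈ G.edgeSet, 0 < w e ∧ w e < ∞) (h₀ : v 0 = t i₀)
    (hadj : ∀ i < n, G.Adj (v i) (v (i + 1))) {i j : ℕ} (hi : i ≤ n) (hj : j ≤ n) :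
    pathDist G w t v i ≤ |pathPos w v i - pathPos w v j| + pathDist G w t v j := by
  refine ENNReal.toReal_le_of_le_ofReal (add_nonneg (abs_nonneg _) (pathDist_nonneg j)) ?_
  rw [ENNReal.ofReal_add (abs_nonneg _) (pathDist_nonneg j), ofReal_pathDist hw h₀ hadj hj]
  exact (termDist_le_add _ _).trans (add_le_add (wdist_path_le_abs hw hadj hi hj) le_rfl)

theorem pathStart_le (i : ℕ) : pathStart G w t v i ≤ i := intervalStart_le i

theorem pathPos_sub_pathStart_le (i : ℕ) : pathPos w v i - pathPos w v (pathStart G w t v i) ≤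
    delta k / 4 * pathDist G w t v (pathStart G w t v i) :=
  pos_sub_intervalStart_le (delta_nonneg k) pathDist_nonneg i

theorem abs_pathPos_sub_le {i j : ℕ} (h : pathStart G w t v i = pathStart G w t v j) :
    |pathPos w v i - pathPos w v j| ≤ delta k / 4 * pathDist G w t v (pathStart G w t v i) := by
  have hi := pathPos_sub_pathStart_le (G := G) (w := w) (t := t) (v := v) i
  have hj := pathPos_sub_pathStart_le (G := G) (w := w) (t := t) (v := v) j
  have hi' := pathPos_mono (w := w) (v := v) (pathStart_le (G := G) (w := w) (t := t) (v := v) i)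
  have hj' := pathPos_mono (w := w) (v := v) (pathStart_le (G := G) (w := w) (t := t) (v := v) j)
  rw [← h] at hj hj'
  rw [abs_le]
  constructor <;> linarith

theorem abs_pathDist_sub_le (hw : ∀ e ∈ G.edgeSet, 0 < w e ∧ w e < ∞) (h₀ : v 0 = t i₀)
    (hadj : ∀ i < n, G.Adj (v i) (v (i + 1))) {i : ℕ} (hi : i ≤ n) :
    |pathDist G w t v i - pathDist G w t v (pathStart G w t v i)| ≤
      delta k / 4 * pathDist G w t v (pathStart G w t v i) := by
  have hs := pathStart_le (G := G) (w := w) (t := t) (v := v) i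
  have h := pathPos_sub_pathStart_le (G := G) (w := w) (t := t) (v := v) i
  have h₁ := pathDist_le_add hw h₀ hadj hi (hs.trans hi)
  have h₂ := pathDist_le_add hw h₀ hadj (hs.trans hi) hi
  rw [abs_of_nonneg (sub_nonneg.2 (pathPos_mono hs))] at h₁
  rw [abs_sub_comm, abs_of_nonneg (sub_nonneg.2 (pathPos_mono hs))] at h₂
  rw [abs_le]
  constructor <;> linarith

theorem mem_cluster_of_path {Vp : Set V} {j : Fin k} {R : ℝ} {i i' : ℕ}
    (hadj : ∀ i < n, G.Adj (v i) (v (i + 1))) (hi : i ≤ n) (hi' : i' ≤ n)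
    (hmem : v i ∈ cluster G w t Vp j R)
    (hgood : ∀ x, min i i' ≤ x → x ≤ max i i' → v x ∈ Vp ∧
      wdist G w (v x) (t j) ≤ ENNReal.ofReal R * termDist G w t (v x)) :
    v i' ∈ cluster G w t Vp j R := by
  rcases le_total i i' with h | h
  · rw [min_eq_left h, max_eq_right h] at hgood
    have key : ∀ x, i ≤ x → x ≤ i' → v x ∈ cluster G w t Vp j R := by
      intro x hx
      induction x, hx using Nat.le_induction with
      | base => exact fun _ => hmem
      | succ x hx ih =>
        intro hx'
        have := hgood (x + 1) (by omega) hx'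
        exact mem_cluster_of_adj (ih (by omega)) (hadj x (by omega)) this.1 this.2
    exact key i' h le_rfl
  · rw [min_eq_right h, max_eq_left h] at hgood
    refine Nat.decreasingInduction' (P := fun x => v x ∈ cluster G w t Vp j R)
      (fun x hx hx' ih => ?_) h hmem
    have := hgood x hx' hx.le
    exact mem_cluster_of_adj ih (hadj x (by omega)).symm this.1 this.2

/-- A cluster that meets a slice contains the slice if its magnitude is increased by the factor
`1 + δ`. -/
theorem mem_cluster_of_sliceStart_eq (hw : ∀ e ∈ G.edgeSet, 0 < w e ∧ w e < ∞) (h₀ : v 0 = t i₀)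
    (hadj : ∀ i < n, G.Adj (v i) (v (i + 1))) (hδ : delta k ≤ 1) {A : Finset ℕ}
    (hAn : ∀ i ∈ A, i ≤ n) {Vp : Set V} (hA : ∀ i ∈ A, v i ∈ Vp ∨ v i ∈ Set.range t)
    {j : Fin k} {R : ℝ} (hR : 1 ≤ R) {i i' : ℕ} (hi : i ∈ A) (hi' : i' ∈ A)
    (hmem : v i ∈ cluster G w t Vp j R)
    (hs : sliceStart (pathStart G w t v) A i = sliceStart (pathStart G w t v) A i') :
    v i' ∈ cluster G w t Vp j (R * (1 + delta k)) := by
  have hδ₀ := delta_nonneg k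
  have hmem' := cluster_mono (le_mul_of_one_le_right (zero_le_one.trans hR)
    (le_add_of_nonneg_right hδ₀)) hmem
  rcases eq_or_ne i i' with rfl | hne
  · exact hmem'
  set D := pathDist G w t v with hD
  set s := pathStart G w t v with hsdef
  have hslice : ∀ x, min i i' ≤ x → x ≤ max i i' → s x = s i ∧ x ∈ A := by
    intro x hx hx'
    have hli := sliceStart_le (s := s) (A := A) i
    have hli' := sliceStart_le (s := s) (A := A) i'
    rcases le_or_gt x i with h | h
    · obtain ⟨-, h₁, h₂⟩ := sliceStart_eq_of_mem_Icc (s := s) (A := A) (i := i) (x := x)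
        (by omega) h
      exact ⟨h₁, h₂ hi⟩
    · obtain ⟨-, h₁, h₂⟩ := sliceStart_eq_of_mem_Icc (s := s) (A := A) (i := i') (x := x)
        (by omega) (by omega)
      refine ⟨h₁.trans ?_, h₂ hi'⟩
      rw [← label_sliceStart (s := s) (A := A) i', ← hs, label_sliceStart (s := s)]
  -- Two distinct vertices of a slice are a positive distance apart along the path, which forces the
  -- interval to have positive length. Then `D` is positive throughout, so no terminal obstructs the
  -- slice.
  have hposD : 0 < D (s i) := by
    have hne' : pathPos w v i ≠ pathPos w v i' := by
      rcases lt_or_gt_of_ne hne with h | h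
      · exact (pathPos_lt hw hadj h (hAn i' hi')).ne
      · exact (pathPos_lt hw hadj h (hAn i hi)).ne'
    have h₁ := abs_pathPos_sub_le (hslice i' (min_le_right _ _) (le_max_right _ _)).1.symm
    have h₂ := abs_pos.2 (sub_ne_zero.2 hne')
    have h₃ : 0 < delta k / 4 * D (s i) := h₂.trans_le h₁
    exact pos_of_mul_pos_right h₃ (by linarith)
  refine mem_cluster_of_path hadj (hAn i hi) (hAn i' hi') hmem' fun x hx hx' => ?_
  obtain ⟨hsx, hxA⟩ := hslice x hx hx'
  have hxn := hAn x hxA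
  have hDx := abs_le.1 (abs_pathDist_sub_le hw h₀ hadj hxn)
  rw [← hD, ← hsdef, hsx] at hDx
  have hDx₀ : 0 < D x := by nlinarith
  refine ⟨(hA x hxA).resolve_right ?_, ?_⟩
  · rintro ⟨l, hl⟩
    refine hDx₀.ne' ?_
    rw [hD, pathDist, ← hl, termDist_terminal, ENNReal.toReal_zero]
  · have hxi := abs_pathPos_sub_le hsx
    rw [← hD, ← hsdef, hsx] at hxi
    have hDi := pathDist_le_add hw h₀ hadj (hAn i hi) hxn
    rw [← hD, abs_sub_comm] at hDi
    have hRR : (0 : ℝ) ≤ R := zero_le_one.trans hR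
    calc wdist G w (v x) (t j) ≤ wdist G w (v x) (v i) + wdist G w (v i) (t j) :=
          wdist_triangle _ _ _
      _ ≤ ENNReal.ofReal |pathPos w v x - pathPos w v i| +
          ENNReal.ofReal R * termDist G w t (v i) :=
          add_le_add (wdist_path_le_abs hw hadj hxn (hAn i hi)) (wdist_le_of_mem_cluster hmem)
      _ = ENNReal.ofReal (|pathPos w v x - pathPos w v i| + R * D i) := by
          rw [← ofReal_pathDist hw h₀ hadj (hAn i hi), ← ENNReal.ofReal_mul hRR,
            ENNReal.ofReal_add (abs_nonneg _) (mul_nonneg hRR (pathDist_nonneg i))]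
      _ ≤ ENNReal.ofReal (R * (1 + delta k) * D x) := by
          refine ENNReal.ofReal_le_ofReal ?_
          have e₁ : |pathPos w v x - pathPos w v i| ≤ R * |pathPos w v x - pathPos w v i| :=
            le_mul_of_one_le_left (abs_nonneg _) hR
          have e₂ : R * D i ≤ R * (|pathPos w v x - pathPos w v i| + D x) := by gcongr
          -- Twice the slice length is at most `δ / 2 * D (s i)`, while `D x ≥ 3 / 4 * D (s i)`:
          -- this is the reason for the factor `δ / 4` in the intervals.
          have e₃ : R * (2 * |pathPos w v x - pathPos w v i|) ≤ R * (delta k * D x) := by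
            refine mul_le_mul_of_nonneg_left ?_ hRR
            have : delta k * (3 / 4 * D (s i)) ≤ delta k * D x :=
              mul_le_mul_of_nonneg_left (by nlinarith) hδ₀
            nlinarith [mul_nonneg hδ₀ hposD.le]
          linarith
      _ = _ := by
          rw [ENNReal.ofReal_mul (mul_nonneg hRR (by linarith)), ofReal_pathDist hw h₀ hadj hxn]

/-- Within an interval `D` is at most twice its value at the start, and the charge carries a factor
`δ`. -/
theorem endSum_le_endCharge (hw : ∀ e ∈ G.edgeSet, 0 < w e ∧ w e < ∞) (h₀ : v 0 = t i₀)
    (hadj : ∀ i < n, G.Adj (v i) (v (i + 1))) (hδ₀ : 0 < delta k) (hδ : delta k ≤ 1)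
    {T : Finset ℕ} (hT : ∀ i ∈ T, i ≤ n) :
    endSum (fun i => termDist G w t (v i)) T ≤ ENNReal.ofReal (2 / delta k *
      endCharge (pathStart G w t v) (fun i => delta k * pathDist G w t v i) T) := by
  by_cases h : T.Nonempty
  · have key : ∀ i ∈ T, pathDist G w t v i ≤ 2 * pathDist G w t v (pathStart G w t v i) := by
      intro i hi
      have h₁ := (abs_le.1 (abs_pathDist_sub_le hw h₀ hadj (hT i hi))).2
      have h₂ := pathDist_nonneg (G := G) (w := w) (t := t) (v := v) (pathStart G w t v i)
      nlinarith
    rw [endSum, dif_pos h, endCharge, dif_pos h,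
      ← ofReal_pathDist hw h₀ hadj (hT _ (T.min'_mem h)),
      ← ofReal_pathDist hw h₀ hadj (hT _ (T.max'_mem h)),
      ← ENNReal.ofReal_add (pathDist_nonneg _) (pathDist_nonneg _)]
    refine ENNReal.ofReal_le_ofReal ((add_le_add (key _ (T.min'_mem h))
      (key _ (T.max'_mem h))).trans (le_of_eq ?_))
    field_simp
  · rw [endSum, dif_neg h]
    exact bot_le

end Path

end NoisyVoronoi

namespace NoisyVoronoi

/-! ### Geometric draws and integration over one coordinate -/

section Draws

instance (p : unitInterval) : IsProbabilityMeasure (geo p) :=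
  Measure.isProbabilityMeasure_map (measurable_of_countable _).aemeasurable

instance (k : ℕ) : IsProbabilityMeasure (draws k) := by
  unfold draws
  infer_instance

/-- The law of a single draw. -/
noncomputable def drawLaw : Measure ℕ := geo ⟨1 / 5, by norm_num, by norm_num⟩

instance : IsProbabilityMeasure drawLaw := by
  unfold drawLaw
  infer_instance

theorem draws_eq_pi (k : ℕ) : draws k = Measure.pi fun _ => drawLaw := rfl

theorem lintegral_drawLaw (f : ℕ → ℝ≥0∞) :
    ∫⁻ x, f x ∂drawLaw = ∑' h : ℕ, ENNReal.ofReal ((4 / 5) ^ h * (1 / 5)) * f (h + 1) := by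
  have hp : (⟨1 / 5, by norm_num, by norm_num⟩ : unitInterval) ≠ 0 := by
    intro h
    have := congrArg Subtype.val h
    norm_num at this
  rw [drawLaw, geo, lintegral_map (measurable_of_countable _) (measurable_of_countable _),
    geometricMeasure_eq hp, lintegral_sum_measure]
  refine tsum_congr fun h => ?_
  rw [lintegral_smul_measure, lintegral_dirac, smul_eq_mul]
  norm_num

/-- A bound on an expectation over one draw, from a sequence `B h` that bounds the conditional
expectation when the draw exceeds `h`. -/
theorem lintegral_drawLaw_le {f B : ℕ → ℝ} (hf : ∀ h, 0 ≤ f h) (hB : ∀ h, 0 ≤ B h)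
    (hstep : ∀ h, 1 / 5 * f (h + 1) + 4 / 5 * B (h + 1) ≤ B h) :
    ∫⁻ x, ENNReal.ofReal (f x) ∂drawLaw ≤ ENNReal.ofReal (B 0) := by
  rw [lintegral_drawLaw]
  -- Telescoping: `(4 / 5) ^ N` is the probability that the draw exceeds `N`, in which case `B N` is
  -- still to be accounted for.
  have key : ∀ N : ℕ, ∑ h ∈ Finset.range N, (4 / 5 : ℝ) ^ h * (1 / 5) * f (h + 1) +
      (4 / 5) ^ N * B N ≤ B 0 := by
    intro N
    induction N with
    | zero => simp
    | succ N ih =>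
      have h₁ := mul_le_mul_of_nonneg_left (hstep N) (pow_nonneg (by norm_num : (0 : ℝ) ≤ 4 / 5) N)
      rw [Finset.sum_range_succ, pow_succ]
      linarith
  refine ENNReal.tsum_le_of_sum_range_le fun N => ?_
  have hnn : ∀ h : ℕ, (0 : ℝ) ≤ (4 / 5) ^ h * (1 / 5) := fun h => by positivity
  calc ∑ h ∈ Finset.range N, ENNReal.ofReal ((4 / 5) ^ h * (1 / 5)) * ENNReal.ofReal (f (h + 1))
      = ENNReal.ofReal (∑ h ∈ Finset.range N, (4 / 5 : ℝ) ^ h * (1 / 5) * f (h + 1)) := by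
        rw [ENNReal.ofReal_sum_of_nonneg fun h _ => mul_nonneg (hnn h) (hf _)]
        exact Finset.sum_congr rfl fun h _ => (ENNReal.ofReal_mul (hnn h)).symm
    _ ≤ _ := ENNReal.ofReal_le_ofReal (by
        have := key N
        have := mul_nonneg (pow_nonneg (by norm_num : (0 : ℝ) ≤ 4 / 5) N) (hB N)
        linarith)

theorem drawLaw_Ioi_le (m : ℕ) : drawLaw (Set.Ioi m) ≤ ENNReal.ofReal ((4 / 5) ^ m) := by
  have h := lintegral_drawLaw_le (f := (Set.Ioi m).indicator 1) (B := fun h => (4 / 5) ^ (m - h))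
    (fun h => Set.indicator_nonneg (fun _ _ => zero_le_one) h) (fun h => by positivity) fun h => by
      rcases lt_or_ge h m with hm | hm
      · rw [Set.indicator_of_notMem (by simp; omega), show m - h = m - (h + 1) + 1 by omega,
          pow_succ]
        linarith
      · rw [Set.indicator_of_mem (by simp; omega), show m - h = 0 by omega,
          show m - (h + 1) = 0 by omega]
        norm_num
  rw [← lintegral_indicator_one measurableSet_Ioi]
  convert! h using 3 with x
  by_cases hx : x ∈ Set.Ioi m
  · simp [hx]
  · simp [hx]

theorem draws_Ioi_le {k : ℕ} (j : Fin k) (m : ℕ) :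
    draws k {g | m < g j} ≤ ENNReal.ofReal ((4 / 5) ^ m) := by
  refine le_trans (le_of_eq ?_) (drawLaw_Ioi_le m)
  have := (measurePreserving_eval (fun _ : Fin k => drawLaw) j).measure_preimage
    (measurableSet_Ioi (a := m)).nullMeasurableSet
  exact this

/-- Fubini for the product measure: integrate coordinate `j` first. This replaces conditional
expectations given the earlier draws. -/
theorem lintegral_draws_le_of_update {k : ℕ} (j : Fin k) {f F : (Fin k → ℕ) → ℝ≥0∞}
    (h : ∀ g, ∫⁻ x, f (Function.update g j x) ∂drawLaw ≤ F g)
    (hF : ∀ g x, F (Function.update g j x) = F g) :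
    ∫⁻ g, f g ∂draws k ≤ ∫⁻ g, F g ∂draws k := by
  rw [draws_eq_pi]
  refine lintegral_le_of_lmarginal_le {j} (measurable_of_countable _) (measurable_of_countable _)
    fun g => ?_
  rw [lmarginal_singleton, lmarginal_singleton]
  simp only [hF, lintegral_const, measure_univ, mul_one]
  exact h g

end Draws

/-! ### The exponential supermartingale and the tail of the charge -/

section Charge

variable {V : Type*} {G : SimpleGraph V} {w : Sym2 V → ℝ≥0∞} {k : ℕ} {t : Fin k → V}

theorem activeSet_congr {n : ℕ} {Z Z' : ℕ → Set ℕ} (j : ℕ) (h : ∀ i < j, Z i = Z' i) :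
    activeSet n Z j = activeSet n Z' j := by
  induction j with
  | zero => rfl
  | succ j ih => rw [activeSet, activeSet, ih fun i hi => h i (by omega), h j (by omega)]

theorem clusterIndices_update {v : ℕ → V} (g : Fin k → ℕ) (j : Fin k) (x i : ℕ) (hi : i < j) :
    clusterIndices G w t (Function.update g j x) v i = clusterIndices G w t g v i := by
  have hg : ∀ l : Fin k, (l : ℕ) < j → Function.update g j x l = g l := fun l hl =>
    Function.update_of_ne (fun h => by rw [h] at hl; exact lt_irrefl _ hl) _ _
  simp only [clusterIndices, clusterOf]
  rw [perp_congr i fun l hl => hg l (by omega)]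
  ext y
  refine exists_congr fun h => ?_
  rw [hg ⟨i, h⟩ hi]

theorem clusterIndices_update_self {v : ℕ → V} (g : Fin k → ℕ) (j : Fin k) (x : ℕ) :
    clusterIndices G w t (Function.update g j x) v j =
      {i | v i ∈ cluster G w t (perp G w t g j) j ((1 + delta k) ^ x)} := by
  have hp : perp G w t (Function.update g j x) j = perp G w t g j :=
    perp_congr j fun l hl =>
      Function.update_of_ne (fun h => by rw [h] at hl; exact lt_irrefl _ hl) _ _
  ext y
  simp [clusterIndices, clusterOf, hp]

/-- The total weight of the ends of the intervals that are deactivated in the first `j` rounds. -/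
noncomputable def pathCharge (G : SimpleGraph V) (w : Sym2 V → ℝ≥0∞) (t : Fin k → V) (v : ℕ → V)
    (n : ℕ) (g : Fin k → ℕ) (j : ℕ) : ℝ :=
  ∑ i ∈ Finset.range j, endCharge (pathStart G w t v) (fun i => delta k * pathDist G w t v i)
    (hitSet n (clusterIndices G w t g v) i)

/-- The slices that are active after `j` rounds, by weight, and a tenth of the charge so far. -/
noncomputable def pathPotential (G : SimpleGraph V) (w : Sym2 V → ℝ≥0∞) (t : Fin k → V) (v : ℕ → V)
    (n : ℕ) (g : Fin k → ℕ) (j : ℕ) : ℝ :=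
  sliceSum (pathStart G w t v) (fun i => delta k * pathDist G w t v i)
    (activeSet n (clusterIndices G w t g v) j) + pathCharge G w t v n g j / 10

variable {v : ℕ → V} {n : ℕ} {i₀ : Fin k}

theorem pathCharge_update (g : Fin k → ℕ) (j : Fin k) (x : ℕ) :
    pathCharge G w t v n (Function.update g j x) j = pathCharge G w t v n g j := by
  refine Finset.sum_congr rfl fun i hi => ?_
  have hi := Finset.mem_range.1 hi
  rw [hitSet, hitSet, activeSet_congr i fun l hl => clusterIndices_update g j x l (by omega),
    clusterIndices_update g j x i hi]

theorem pathPotential_update (g : Fin k → ℕ) (j : Fin k) (x : ℕ) :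
    pathPotential G w t v n (Function.update g j x) j = pathPotential G w t v n g j := by
  rw [pathPotential, pathPotential, pathCharge_update,
    activeSet_congr j fun l hl => clusterIndices_update g j x l hl]

/-- Reveal the draw level by level. Given that it exceeds `h`, the expectation is bounded by `exp (η
* (Y - 4 / 5 * W))`, where `Y` is the old potential and `W` the weight of the slices met at level
`h`: these will certainly be swallowed. -/
theorem lintegral_exp_pathPotential_update_le (hw : ∀ e ∈ G.edgeSet, 0 < w e ∧ w e < ∞)
    (h₀ : v 0 = t i₀) (hadj : ∀ i < n, G.Adj (v i) (v (i + 1))) (hδ : delta k ≤ 1) {η : ℝ}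
    (hη : 0 ≤ η) (hη' : η * (2 * (delta k * pathPos w v n)) ≤ 1 / 4) (g : Fin k → ℕ) (j : Fin k) :
    ∫⁻ x, ENNReal.ofReal
        (Real.exp (η * pathPotential G w t v n (Function.update g j x) (j + 1))) ∂drawLaw ≤
      ENNReal.ofReal (Real.exp (η * pathPotential G w t v n g j)) := by
  set s := pathStart G w t v with hs
  set μ : ℕ → ℝ := fun i => delta k * pathDist G w t v i with hμ
  set A := activeSet n (clusterIndices G w t g v) j with hA
  set X := pathCharge G w t v n g j with hX
  let T : ℕ → Finset ℕ := fun x =>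
    touched A {i | v i ∈ cluster G w t (perp G w t g j) j ((1 + delta k) ^ x)}
  have hμ₀ : ∀ i, 0 ≤ μ i := fun i => mul_nonneg (delta_nonneg k) (pathDist_nonneg i)
  have hAn : ∀ i ∈ A, i ≤ n := fun i hi => (mem_activeSet.1 hi).1
  have hAV : ∀ i ∈ A, v i ∈ perp G w t g j ∨ v i ∈ Set.range t := by
    intro i hi
    by_cases ht : v i ∈ Set.range t
    · exact .inr ht
    · exact .inl ((mem_perp_iff _ _).2 ⟨ht, fun l hl h => not_mem_of_mem_activeSet hi hl ⟨l.2, h⟩⟩)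
  have hM : ∀ i ∈ A, μ (s i) ≤ delta k * pathPos w v n := by
    intro i hi
    have hsn : s i ≤ n := (pathStart_le i).trans (hAn i hi)
    exact mul_le_mul_of_nonneg_left
      ((pathDist_le_pathPos hw h₀ hadj hsn).trans (pathPos_mono hsn)) (delta_nonneg k)
  have hM₀ : 0 ≤ delta k * pathPos w v n :=
    mul_nonneg (delta_nonneg k) (pathPos_zero (w := w) (v := v) ▸ pathPos_mono (Nat.zero_le n))
  have hpot : ∀ x, pathPotential G w t v n (Function.update g j x) (j + 1) =
      sliceSum s μ (removeSpan A (T x)) + (X + endCharge s μ (T x)) / 10 := by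
    intro x
    have hact : activeSet n (clusterIndices G w t (Function.update g j x) v) j = A :=
      activeSet_congr j fun l hl => clusterIndices_update g j x l hl
    rw [pathPotential, activeSet, hact, clusterIndices_update_self, pathCharge,
      Finset.sum_range_succ, ← pathCharge, pathCharge_update, hitSet, hact,
      clusterIndices_update_self]
  have hstep : ∀ h, ∃ x, 0 ≤ x ∧ x ≤ 2 * (delta k * pathPos w v n) ∧
      sliceSum s μ (removeSpan A (T (h + 1))) + endCharge s μ (T (h + 1)) / 10 ≤
        sliceSum s μ A + 11 / 10 * x - 4 / 5 * touchedSum s μ A (T h) ∧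
      touchedSum s μ A (T h) + x / 2 ≤ touchedSum s μ A (T (h + 1)) := by
    intro h
    refine exists_slice_step hμ₀ hM₀ hM (fun i hi => (mem_touched.1 hi).1) ?_ ?_
    · intro i hi
      refine mem_touched.2 ⟨(mem_touched.1 hi).1, cluster_mono ?_ (mem_touched.1 hi).2⟩
      exact pow_le_pow_right₀ (le_add_of_nonneg_right (delta_nonneg k)) h.le_succ
    · intro i hi i' hi' heq
      refine mem_touched.2 ⟨hi', ?_⟩
      have := mem_cluster_of_sliceStart_eq hw h₀ hadj hδ hAn hAV (one_le_radius k h)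
        (mem_touched.1 hi).1 hi' (mem_touched.1 hi).2 heq
      rw [← pow_succ] at this
      exact this
  simp only [hpot]
  refine (lintegral_drawLaw_le
    (f := fun x => Real.exp (η * (sliceSum s μ (removeSpan A (T x)) +
      (X + endCharge s μ (T x)) / 10)))
    (B := fun h => Real.exp (η * (pathPotential G w t v n g j - 4 / 5 * touchedSum s μ A (T h))))
    (fun _ => (Real.exp_pos _).le) (fun _ => (Real.exp_pos _).le) fun h => ?_).trans ?_
  · obtain ⟨x, hx₀, hx₁, hx₂, hx₃⟩ := hstep h
    refine exp_step_le hη hx₀ ((mul_le_mul_of_nonneg_left hx₁ hη).trans hη') ?_ hx₃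
    rw [pathPotential]
    linarith
  -- Draws start at `1`, so level `0` is only the starting bound; its touched weight is nonnegative
  -- and is dropped.
  · refine ENNReal.ofReal_le_ofReal (Real.exp_le_exp.2 (mul_le_mul_of_nonneg_left ?_ hη))
    have : 0 ≤ touchedSum s μ A (T 0) := Finset.sum_nonneg fun _ _ => hμ₀ _
    linarith

theorem lintegral_exp_pathPotential_le (hw : ∀ e ∈ G.edgeSet, 0 < w e ∧ w e < ∞)
    (h₀ : v 0 = t i₀) (hadj : ∀ i < n, G.Adj (v i) (v (i + 1))) (hδ : delta k ≤ 1) {η : ℝ}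
    (hη : 0 ≤ η) (hη' : η * (2 * (delta k * pathPos w v n)) ≤ 1 / 4) :
    ∫⁻ g, ENNReal.ofReal (Real.exp (η * pathPotential G w t v n g k)) ∂draws k ≤
      ENNReal.ofReal (Real.exp (η * (5 * pathPos w v n))) := by
  have hmain : ∀ j ≤ k, ∫⁻ g, ENNReal.ofReal (Real.exp (η * pathPotential G w t v n g j)) ∂draws k ≤
      ENNReal.ofReal (Real.exp (η * (5 * pathPos w v n))) := by
    intro j
    induction j with
    | zero =>
      intro _
      -- The intervals cost `4 * L`; the unpaid last one adds at most `δ * L ≤ L`.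
      have hsum : ∀ g, pathPotential G w t v n g 0 ≤ 5 * pathPos w v n := by
        intro g
        have hsn := pathStart_le (G := G) (w := w) (t := t) (v := v) n
        have h₁ := sliceSum_range_le (pos := pathPos w v) (D := pathDist G w t v) pathDist_nonneg
          (delta_nonneg k) pathPos_zero n
        have h₂ := pathPos_mono (w := w) (v := v) hsn
        have h₃ := pathDist_le_pathPos hw h₀ hadj hsn
        have h₄ := pathDist_nonneg (G := G) (w := w) (t := t) (v := v) (pathStart G w t v n)
        have h₅ := mul_le_mul_of_nonneg_right hδ h₄
        simp only [pathPotential, activeSet, pathCharge, Finset.sum_range_zero]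
        simp only [pathStart] at *
        linarith
      calc _ ≤ ∫⁻ _, ENNReal.ofReal (Real.exp (η * (5 * pathPos w v n))) ∂draws k :=
            lintegral_mono fun g => ENNReal.ofReal_le_ofReal
              (Real.exp_le_exp.2 (mul_le_mul_of_nonneg_left (hsum g) hη))
        _ = _ := by simp
    | succ j ih =>
      intro hj
      refine le_trans ?_ (ih (by omega))
      refine lintegral_draws_le_of_update ⟨j, hj⟩
        (fun g => lintegral_exp_pathPotential_update_le hw h₀ hadj hδ hη hη' g ⟨j, hj⟩)
        fun g x => ?_
      rw [pathPotential_update g ⟨j, hj⟩ x]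
  exact hmain k le_rfl

theorem delta_le_one {k : ℕ} (hk : 2 ≤ k) : delta k ≤ 1 := by
  have h₁ : Real.log 2 ≤ Real.log k := Real.log_le_log (by norm_num) (by exact_mod_cast hk)
  have h₂ := Real.log_two_gt_d9
  rw [delta, div_le_one (by linarith)]
  linarith

theorem delta_pos {k : ℕ} (hk : 2 ≤ k) : 0 < delta k := by
  have : 0 < Real.log k := Real.log_pos (by exact_mod_cast hk)
  rw [delta]
  positivity

theorem draws_pathCharge_ge_le (hw : ∀ e ∈ G.edgeSet, 0 < w e ∧ w e < ∞) (hk : 2 ≤ k)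
    (h₀ : v 0 = t i₀) (hadj : ∀ i < n, G.Adj (v i) (v (i + 1))) (hL : 0 < pathPos w v n) :
    draws k {g | 66 * pathPos w v n ≤ pathCharge G w t v n g k} ≤
      ENNReal.ofReal (1 / (k : ℝ) ^ 4) := by
  set L := pathPos w v n with hLdef
  have hδ := delta_pos hk
  have hk₀ : (0 : ℝ) < k := by positivity
  -- Slices weigh at most `δ * L`, so this is the largest `η` with `η * (2 * δ * L) ≤ 1 / 4`.
  set η : ℝ := 1 / (8 * (delta k * L)) with hη
  have hη₀ : 0 ≤ η := by positivity
  have hint := lintegral_exp_pathPotential_le hw h₀ hadj (delta_le_one hk) hη₀ (by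
    rw [← hLdef, hη]
    apply le_of_eq
    field_simp
    norm_num)
  have hmarkov := mul_meas_ge_le_lintegral (μ := draws k)
    (f := fun g => ENNReal.ofReal (Real.exp (η * pathPotential G w t v n g k)))
    (measurable_of_countable _) (ENNReal.ofReal (Real.exp (η * (33 / 5 * L))))
  have hsub : draws k {g | 66 * L ≤ pathCharge G w t v n g k} ≤ draws k {g |
      ENNReal.ofReal (Real.exp (η * (33 / 5 * L))) ≤
        ENNReal.ofReal (Real.exp (η * pathPotential G w t v n g k))} := by
    refine measure_mono fun g hg => ENNReal.ofReal_le_ofReal (Real.exp_le_exp.2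
      (mul_le_mul_of_nonneg_left ?_ hη₀))
    have hnn : 0 ≤ sliceSum (pathStart G w t v) (fun i => delta k * pathDist G w t v i)
        (activeSet n (clusterIndices G w t g v) k) :=
      Finset.sum_nonneg fun _ _ => mul_nonneg hδ.le (pathDist_nonneg _)
    have hg : 66 * L ≤ pathCharge G w t v n g k := hg
    rw [pathPotential]
    linarith
  -- A charge of `66 * L` forces potential `33 / 5 * L`, an excess of `8 / 5 * L` over the initial
  -- bound; and `η * (8 / 5 * L) = 1 / (5 * δ) = 4 * log k`.
  have hexp : Real.exp (η * (5 * L)) = Real.exp (η * (33 / 5 * L)) * (1 / (k : ℝ) ^ 4) := by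
    have h₁ : (1 / (k : ℝ) ^ 4) = Real.exp (-(4 * Real.log k)) := by
      rw [Real.exp_neg, show 4 * Real.log k = Real.log ((k : ℝ) ^ 4) by
        rw [Real.log_pow]; norm_num, Real.exp_log (by positivity), one_div]
    rw [h₁, ← Real.exp_add]
    congr 1
    have hlog : Real.log k = 1 / (20 * delta k) := by
      have : 0 < Real.log k := Real.log_pos (by exact_mod_cast hk)
      rw [delta]
      field_simp
    rw [hlog, hη]
    field_simp
    norm_num
  have hpos : ENNReal.ofReal (Real.exp (η * (33 / 5 * L))) ≠ 0 := by
    simpa using Real.exp_pos _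
  refine hsub.trans ((ENNReal.mul_le_mul_iff_right hpos ENNReal.ofReal_ne_top).1
    ((hmarkov.trans hint).trans (le_of_eq ?_)))
  rw [← ENNReal.ofReal_mul (Real.exp_pos _).le, hexp]

end Charge

end NoisyVoronoi

namespace NoisyVoronoi

/-! ### Bounded magnitudes and the union bound -/

section Distortion

variable {V : Type*} {G : SimpleGraph V} {w : Sym2 V → ℝ≥0∞} {k : ℕ} {t : Fin k → V}

/-- A bound on the draws that holds with high probability. -/
noncomputable def drawBound (k : ℕ) : ℕ := ⌈15 * Real.log k⌉₊

/-- Since `4 / 5 ≤ exp (-1 / 5)`, the factor `15` in `drawBound` yields the exponent `3`. -/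
theorem four_fifths_pow_drawBound_le {k : ℕ} (hk : 2 ≤ k) :
    (4 / 5 : ℝ) ^ drawBound k ≤ 1 / (k : ℝ) ^ 3 := by
  have hk₀ : (0 : ℝ) < k := by positivity
  have h₁ : (4 / 5 : ℝ) ≤ Real.exp (-(1 / 5)) := by
    have := Real.add_one_le_exp (-(1 / 5 : ℝ))
    linarith
  have h₂ := Nat.le_ceil (15 * Real.log k)
  calc (4 / 5 : ℝ) ^ drawBound k ≤ Real.exp (-(1 / 5)) ^ drawBound k :=
        pow_le_pow_left₀ (by norm_num) h₁ _
    _ = Real.exp (drawBound k * -(1 / 5)) := (Real.exp_nat_mul _ _).symm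
    _ ≤ Real.exp (-Real.log ((k : ℝ) ^ 3)) := by
        refine Real.exp_le_exp.2 ?_
        rw [Real.log_pow, drawBound]
        norm_num
        linarith
    _ = _ := by rw [Real.exp_neg, Real.exp_log (by positivity), one_div]

/-- With `δ = 1 / (20 * log k)` the product `s * δ` stays below `1`; the slack between `15` and `20`
absorbs the rounding up. -/
theorem radius_le_three {k : ℕ} (hk : 2 ≤ k) {s : ℕ} (hs : s ≤ drawBound k) :
    (1 + delta k) ^ s ≤ 3 := by
  have hδ := delta_pos hk
  have h₁ : Real.log 2 ≤ Real.log k := Real.log_le_log (by norm_num) (by exact_mod_cast hk)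
  have h₂ := Real.log_two_gt_d9
  have h₃ : (s : ℝ) ≤ 15 * Real.log k + 1 :=
    (Nat.cast_le.2 hs).trans (Nat.ceil_lt_add_one (by linarith)).le
  calc (1 + delta k) ^ s ≤ Real.exp (delta k) ^ s := by
        refine pow_le_pow_left₀ (by linarith) ?_ _
        rw [add_comm]
        exact Real.add_one_le_exp _
    _ = Real.exp (s * delta k) := (Real.exp_nat_mul _ _).symm
    _ ≤ Real.exp 1 := by
        refine Real.exp_le_exp.2 ?_
        rw [delta, mul_one_div, div_le_one (by linarith)]
        linarith
    _ ≤ 3 := by linarith [Real.exp_one_lt_d9]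

theorem endCharge_nonneg {s : ℕ → ℕ} {μ : ℕ → ℝ} (hμ : ∀ i, 0 ≤ μ i) (T : Finset ℕ) :
    0 ≤ endCharge s μ T := by
  rw [endCharge]
  split_ifs
  · exact add_nonneg (hμ _) (hμ _)
  · exact le_rfl

/-- The distortion of a path whose charge is small. -/
theorem minorDist_le_of_pathCharge_le [Finite V] (hw : ∀ e ∈ G.edgeSet, 0 < w e ∧ w e < ∞)
    (ht : Function.Injective t) (hk : 2 ≤ k) {i₀ i₁ : Fin k} {v : ℕ → V} {n : ℕ} (h₀ : v 0 = t i₀)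
    (h₁ : v n = t i₁) (hadj : ∀ i < n, G.Adj (v i) (v (i + 1))) {g : Fin k → ℕ}
    (hg : ∀ j, g j ≤ drawBound k) (hX : pathCharge G w t v n g k ≤ 66 * pathPos w v n) :
    minorDist G w t (clusterOf G w t g) i₀ i₁ ≤
      ENNReal.ofReal (10000 * Real.log k) * ENNReal.ofReal (pathPos w v n) := by
  have hδ := delta_pos hk
  have hL : 0 ≤ pathPos w v n :=
    pathPos_zero (w := w) (v := v) ▸ pathPos_mono (Nat.zero_le n)
  have hlog : 1 / 2 ≤ Real.log k := by
    have := Real.log_le_log (by norm_num) (show (2 : ℝ) ≤ k by exact_mod_cast hk)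
    linarith [Real.log_two_gt_d9]
  have hμ : ∀ i, 0 ≤ delta k * pathDist G w t v i := fun i =>
    mul_nonneg hδ.le (pathDist_nonneg i)
  have hlen : ∑ i ∈ Finset.range n, w s(v i, v (i + 1)) = ENNReal.ofReal (pathPos w v n) := by
    rw [pathPos, ENNReal.ofReal_sum_of_nonneg fun _ _ => ENNReal.toReal_nonneg]
    refine Finset.sum_congr rfl fun i hi => (ENNReal.ofReal_toReal ?_).symm
    exact (hw s(v i, v (i + 1)) (hadj i (Finset.mem_range.1 hi))).2.ne
  have hend : ∑ j : Fin k, endSum (fun i => termDist G w t (v i))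
      (hitSet n (clusterIndices G w t g v) j) ≤
        ENNReal.ofReal (2 / delta k * pathCharge G w t v n g k) := by
    rw [pathCharge, ← Fin.sum_univ_eq_sum_range (fun j => endCharge (pathStart G w t v)
      (fun i => delta k * pathDist G w t v i) (hitSet n (clusterIndices G w t g v) j)),
      Finset.mul_sum, ENNReal.ofReal_sum_of_nonneg fun j _ =>
        mul_nonneg (by positivity) (endCharge_nonneg hμ _)]
    exact Finset.sum_le_sum fun j _ => endSum_le_endCharge hw h₀ hadj hδ (delta_le_one hk)
      fun i hi => (mem_activeSet.1 (mem_touched.1 hi).1).1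
  calc _ ≤ ENNReal.ofReal (pathPos w v n) +
        ENNReal.ofReal 3 * ENNReal.ofReal (2 / delta k * (66 * pathPos w v n)) := by
        refine (minorDist_le_of_path hw ht h₀ h₁ hadj (R := ENNReal.ofReal 3) fun j =>
          ENNReal.ofReal_le_ofReal (radius_le_three hk (hg j))).trans ?_
        rw [hlen]
        gcongr
        exact hend.trans (ENNReal.ofReal_le_ofReal (by gcongr))
    _ = ENNReal.ofReal (pathPos w v n + 3 * (2 / delta k * (66 * pathPos w v n))) := by
        rw [ENNReal.ofReal_add hL (by positivity), ← ENNReal.ofReal_mul (by norm_num)]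
    _ ≤ ENNReal.ofReal (10000 * Real.log k * pathPos w v n) := by
        refine ENNReal.ofReal_le_ofReal ?_
        -- The detours cost `3 * 40 * 66 * log k = 7920 * log k` times the length, and `log k ≥ 1 /
        -- 2` absorbs the path itself, well within `10000 * log k`.
        have : 2 / delta k = 40 * Real.log k := by
          rw [delta]
          field_simp
          norm_num
        rw [this]
        nlinarith [mul_le_mul_of_nonneg_right hlog hL]
    _ = _ := ENNReal.ofReal_mul (by linarith)

/-- For each pair of terminals the distortion is logarithmic outside an event of small
probability, if the draws are bounded. -/
theorem exists_bad_draws [Finite V] (hw : ∀ e ∈ G.edgeSet, 0 < w e ∧ w e < ∞)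
    (ht : Function.Injective t) (hk : 2 ≤ k) (i₀ i₁ : Fin k) :
    ∃ B : Set (Fin k → ℕ), draws k B ≤ ENNReal.ofReal (1 / (k : ℝ) ^ 4) ∧
      ∀ g ∉ B, (∀ j, g j ≤ drawBound k) → minorDist G w t (clusterOf G w t g) i₀ i₁ ≤
        ENNReal.ofReal (10000 * Real.log k) * wdist G w (t i₀) (t i₁) := by
  by_cases htop : wdist G w (t i₀) (t i₁) = ∞
  · refine ⟨∅, by simp, fun g _ _ => ?_⟩
    have hlog : 0 < Real.log k := Real.log_pos (by exact_mod_cast hk)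
    rw [htop, ENNReal.mul_top]
    · exact le_top
    · simpa using hlog
  obtain ⟨p, hp⟩ := exists_walkWeight_eq_wdist (w := w) (reachable_of_wdist_ne_top htop)
  rcases eq_or_ne i₀ i₁ with rfl | hne
  · refine ⟨∅, by simp, fun g _ _ => ?_⟩
    rw [minorDist, wdist_self]
    exact bot_le
  have h₀ : p.getVert 0 = t i₀ := p.getVert_zero
  have h₁ : p.getVert p.length = t i₁ := p.getVert_length
  have hadj : ∀ i < p.length, G.Adj (p.getVert i) (p.getVert (i + 1)) :=
    fun i hi => p.adj_getVert_succ hi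
  have hlen : 0 < p.length := Nat.pos_of_ne_zero fun h =>
    hne (ht (SimpleGraph.Walk.eq_of_length_eq_zero h))
  have hL : 0 < pathPos w p.getVert p.length :=
    pathPos_zero (w := w) (v := p.getVert) ▸ pathPos_lt hw hadj hlen le_rfl
  have hpos : ENNReal.ofReal (pathPos w p.getVert p.length) = wdist G w (t i₀) (t i₁) := by
    rw [← hp, walkWeight_eq_sum_getVert, pathPos,
      ENNReal.ofReal_sum_of_nonneg fun _ _ => ENNReal.toReal_nonneg]
    refine Finset.sum_congr rfl fun i hi => ENNReal.ofReal_toReal ?_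
    exact (hw s(p.getVert i, p.getVert (i + 1)) (hadj i (Finset.mem_range.1 hi))).2.ne
  refine ⟨_, draws_pathCharge_ge_le hw hk h₀ hadj hL, fun g hg hb => ?_⟩
  rw [← hpos]
  exact minorDist_le_of_pathCharge_le hw ht hk h₀ h₁ hadj hb (not_le.1 hg).le

theorem one_sub_le_draws_real [Finite V] (hw : ∀ e ∈ G.edgeSet, 0 < w e ∧ w e < ∞)
    (ht : Function.Injective t) (hk : 2 ≤ k) :
    1 - 1 / (k : ℝ) ≤ (draws k).real {g | ∀ i j, minorDist G w t (clusterOf G w t g) i j ≤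
      ENNReal.ofReal (10000 * Real.log k) * wdist G w (t i) (t j)} := by
  choose B hB hgood using exists_bad_draws hw ht hk
  have hk₀ : (2 : ℝ) ≤ k := by exact_mod_cast hk
  set E : Set (Fin k → ℕ) := {g | ∀ i j, minorDist G w t (clusterOf G w t g) i j ≤
      ENNReal.ofReal (10000 * Real.log k) * wdist G w (t i) (t j)} with hE
  have hsub : Eᶜ ⊆ (⋃ j, {g | drawBound k < g j}) ∪ ⋃ i, ⋃ j, B i j := by
    intro g hg
    by_contra hcon
    simp only [Set.mem_union, Set.mem_iUnion, not_or, not_exists] at hcon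
    exact hg fun i j => hgood i j g (hcon.2 i j) fun l => not_lt.1 (hcon.1 l)
  have hmeas : draws k Eᶜ ≤ ENNReal.ofReal (1 / k) := by
    calc draws k Eᶜ ≤ ∑ j, draws k {g | drawBound k < g j} + ∑ i, ∑ j, draws k (B i j) := by
          refine (measure_mono hsub).trans ((measure_union_le _ _).trans (add_le_add ?_ ?_))
          · exact measure_iUnion_fintype_le _ _
          · exact (measure_iUnion_fintype_le _ _).trans
              (Finset.sum_le_sum fun i _ => measure_iUnion_fintype_le _ _)
      _ ≤ ∑ _j : Fin k, ENNReal.ofReal (1 / (k : ℝ) ^ 3) +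
          ∑ _i : Fin k, ∑ _j : Fin k, ENNReal.ofReal (1 / (k : ℝ) ^ 4) := by
          gcongr with j _ i _ j _
          · exact (draws_Ioi_le j _).trans
              (ENNReal.ofReal_le_ofReal (four_fifths_pow_drawBound_le hk))
          · exact hB i j
      _ = ENNReal.ofReal (∑ _j : Fin k, 1 / (k : ℝ) ^ 3 +
          ∑ _i : Fin k, ∑ _j : Fin k, 1 / (k : ℝ) ^ 4) := by
          rw [ENNReal.ofReal_add (by positivity) (by positivity),
            ENNReal.ofReal_sum_of_nonneg fun _ _ => by positivity,
            ENNReal.ofReal_sum_of_nonneg fun _ _ => by positivity]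
          simp_rw [ENNReal.ofReal_sum_of_nonneg fun _ _ =>
            (by positivity : (0 : ℝ) ≤ 1 / (k : ℝ) ^ 4)]
      _ ≤ ENNReal.ofReal (1 / k) := by
          refine ENNReal.ofReal_le_ofReal ?_
          simp only [Finset.sum_const, Finset.card_univ, Fintype.card_fin, nsmul_eq_mul]
          -- Large draws and bad pairs each contribute `1 / k ^ 2`; `k ≥ 2` brings the sum below `1
          -- / k`.
          have : (k : ℝ) * (1 / (k : ℝ) ^ 3) + k * (k * (1 / (k : ℝ) ^ 4)) = 2 / k * (1 / k) := by
            field_simp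
            norm_num
          rw [this]
          exact mul_le_of_le_one_left (by positivity) ((div_le_one (by positivity)).2 hk₀)
  have hreal : (draws k).real Eᶜ ≤ 1 / k := by
    rw [measureReal_def]
    exact ENNReal.toReal_le_of_le_ofReal (by positivity) hmeas
  rw [probReal_compl_eq_one_sub (MeasurableSet.of_discrete)] at hreal
  linarith

end Distortion

end NoisyVoronoi

theorem mainTheorem1 :
    ∃ c : ℝ, 0 < c ∧
      ∀ (V : Type*) [Finite V] (G : SimpleGraph V) (w : Sym2 V → ℝ≥0∞)
        (_ : ∀ e ∈ G.edgeSet, 0 < w e ∧ w e < ∞)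
        (k : ℕ) (_ : 2 ≤ k) (t : Fin k → V) (_ : Function.Injective t),
        (∀ g : Fin k → ℕ, ∃ 𝒱, NoisyVoronoi.IsOutput G w t g 𝒱) ∧
        (∀ (g : Fin k → ℕ) (𝒱 : Fin k → Set V), NoisyVoronoi.IsOutput G w t g 𝒱 →
          NoisyVoronoi.IsTerminalPartition G t 𝒱 ∧
          ∀ i j, NoisyVoronoi.wdist G w (t i) (t j) ≤ NoisyVoronoi.minorDist G w t 𝒱 i j) ∧
        1 - 1 / (k : ℝ) ≤ (NoisyVoronoi.draws k).real
          {g | ∀ 𝒱, NoisyVoronoi.IsOutput G w t g 𝒱 → ∀ i j,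
            NoisyVoronoi.minorDist G w t 𝒱 i j ≤
              ENNReal.ofReal (c * Real.log k) * NoisyVoronoi.wdist G w (t i) (t j)} := by
  refine ⟨10000, by norm_num, fun V _ G w hw k hk t ht => ⟨?_, ?_, ?_⟩⟩
  · exact fun g => ⟨_, NoisyVoronoi.isOutput_clusterOf⟩
  · rintro g 𝒱 h𝒱
    obtain rfl := h𝒱.eq_clusterOf
    exact ⟨NoisyVoronoi.isTerminalPartition_clusterOf hw ht, NoisyVoronoi.wdist_le_minorDist _⟩
  · refine (NoisyVoronoi.one_sub_le_draws_real hw ht hk).trans (measureReal_mono ?_)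
    intro g hg 𝒱 h𝒱
    obtain rfl := h𝒱.eq_clusterOf
    exact hg
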